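/- Let $\mathcal{E}\in(0,1)$, let $k=\sqrt{\frac{1-\mathcal{E}}{1+\mathcal{E}}}$, and let $$u_0(x)=\sqrt{1-\mathcal{E}}\;\mathrm{sn}\Bigl(x\sqrt{\tfrac{1+\mathcal{E}}{2}},\,k\Bigr),\qquad x\in\mathbb{R},$$ where $\mathrm{sn}$ is the Jacobi elliptic sine with modulus $k$; $u_0$ is a real solution of $u_0''+(1-u_0^2)u_0=0$ with period $2T_0=4\sqrt{\frac{2}{1+\mathcal{E}}}\,K(k)$, where $K$ is the complete elliptic integral of the first kind. For an interval $\mathcal{I}$ and $\psi:\mathcal I\to\mathbb{C}$ put $$E(\psi)=\int_{\mathcal I}\Bigl[|\psi_x|^2+\tfrac12(1-|\psi|^2)^2\Bigr]dx,\qquad Q(\psi)=\int_{\mathcal I}|\psi|^2\,dx,$$ $$R(\psi)=\int_{\mathcal I}\Bigl[|\psi_{xx}|^2+3|\psi|^2|\psi_x|^2+\tfrac12(\bar\psi\psi_x+\psi\bar\psi_x)^2+\tfrac12|\psi|^6\Bigr]dx,$$ $$S=R-\tfrac12(3-\mathcal{E}^2)\,Q,\qquad \Lambda_c=S-cE .$$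 Fix $c=2$. Then the second variation $\Lambda_2''(u_0)$ is positive except for the two neutral directions $u_0'$ and $iu_0$ due to translations and phase rotations, in the following sense. 1. Let $T=2NT_0$ with an integer $N\ge1$ and $\mathcal I=(0,T)$. For every complex-valued $w\in H^2_{\rm per}(0,T)$, $$\langle\Lambda_2''(u_0)w,w\rangle=\frac{d^2}{d\varepsilon^2}\Big|_{\varepsilon=0}\Lambda_2(u_0+\varepsilon w)\ \ge\ 0,$$ with equality if and only if $w=a\,u_0'+b\,iu_0$ for some $a,b\in\mathbb{R}$. 2. Let $\mathcal I=\mathbb{R}$, and let $\langle\Lambda_2''(u_0)w,\varphi\rangle$ be the integral over $\mathbb{R}$ of $\partial_s\partial_t|_{s=t=0}$ of the density of $\Lambda_2$ at $u_0+sw+t\varphi$. For every nonzero complex-valued $w\in H^2(\mathbb{R})$ one has $\langle\Lambda_2''(u_0)w,w\rangle>0$. 3. With the same form on $\mathbb{R}$, a complex-valued $w\in L^\infty(\mathbb{R})\cap H^2_{\rm loc}(\mathbb{R})$ satisfies $\langle\Lambda_2''(u_0)w,\varphi\rangle=0$ for all $\varphi\in C_c^\infty(\mathbb{R};\mathbb{C})$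 if and only if $w=a\,u_0'+b\,iu_0$ for some $a,b\in\mathbb{R}$. -/

import Mathlib

open MeasureTheory Set
open scoped ContDiff

noncomputable section

namespace CnoidalNLS

/-! ### Jacobi elliptic functions and the periodic wave profile -/

/-- Incomplete elliptic integral of the first kind, `F(φ, k) = ∫₀^φ dθ / √(1 - k² sin² θ)`. -/
def ellipticF (k φ : ℝ) : ℝ :=
  ∫ θ in (0 : ℝ)..φ, 1 / √(1 - k ^ 2 * Real.sin θ ^ 2)

/-- Complete elliptic integral of the first kind. -/
def ellipticK (k : ℝ) : ℝ := ellipticF k (Real.pi / 2)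

/-- Jacobi amplitude: for `0 ≤ k < 1` the map `φ ↦ F(φ, k)` is an increasing bijection of `ℝ`,
and `am(·, k)` is its inverse. -/
def jacobiAm (k ξ : ℝ) : ℝ := Function.invFun (ellipticF k) ξ

/-- Jacobi elliptic sine, `sn(ξ, k) = sin (am(ξ, k))`. -/
def jacobiSn (ξ k : ℝ) : ℝ := Real.sin (jacobiAm k ξ)

/-- The elliptic modulus `k = √((1 - ℰ) / (1 + ℰ))`. -/
def modulus (ℰ : ℝ) : ℝ := √((1 - ℰ) / (1 + ℰ))

/-- The periodic wave profile `u₀(x) = √(1 - ℰ) sn(x √((1 + ℰ) / 2), k)`. -/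
def profile (ℰ x : ℝ) : ℝ :=
  √(1 - ℰ) * jacobiSn (x * √((1 + ℰ) / 2)) (modulus ℰ)

/-- The period `2 T₀ = 4 √(2 / (1 + ℰ)) K(k)` of the profile. -/
def period (ℰ : ℝ) : ℝ := 4 * √(2 / (1 + ℰ)) * ellipticK (modulus ℰ)

/-- The profile as a complex-valued function. -/
def wave (ℰ : ℝ) : ℝ → ℂ := fun x => (profile ℰ x : ℂ)

/-! ### Sobolev spaces on the line

An element of a Sobolev space `H²` in one dimension is represented by its unique `C¹`
representative. -/

/-- `w ∈ H²_loc(ℝ)`: `w` is `C¹`, and `w'` is locally absolutely continuous (it is the integral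
of its almost everywhere derivative) with derivative in `L²_loc`. -/
structure MemH2Loc (w : ℝ → ℂ) : Prop where
  contDiff : ContDiff ℝ 1 w
  memLp : ∀ a b : ℝ, MemLp (deriv (deriv w)) 2 (volume.restrict (Icc a b))
  ftc : ∀ a b : ℝ, ∫ x in a..b, deriv (deriv w) x = deriv w b - deriv w a

/-- `w ∈ H²(ℝ)`. -/
structure MemH2 (w : ℝ → ℂ) : Prop extends MemH2Loc w where
  memLp_zero : MemLp w 2 volume
  memLp_one : MemLp (deriv w) 2 volume
  memLp_two : MemLp (deriv (deriv w)) 2 volume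

/-- `w ∈ H²_per(0, T)`, seen as a `T`-periodic function on `ℝ`. -/
structure MemH2Per (T : ℝ) (w : ℝ → ℂ) : Prop extends MemH2Loc w where
  periodic : Function.Periodic w T

/-! ### Conserved functionals

A density is a function of the values of `ψ`, `ψ_x`, `ψ_xx` at a point. -/

/-- `|ψ_x|² + (1 - |ψ|²)² / 2`. -/
def energyDensity (p p₁ _p₂ : ℂ) : ℝ := ‖p₁‖ ^ 2 + 1 / 2 * (1 - ‖p‖ ^ 2) ^ 2

/-- `|ψ|²`. -/
def chargeDensity (p _p₁ _p₂ : ℂ) : ℝ := ‖p‖ ^ 2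

/-- `|ψ_xx|² + 3 |ψ|² |ψ_x|² + (ψ̄ ψ_x + ψ ψ̄_x)² / 2 + |ψ|⁶ / 2`;
here `ψ̄ ψ_x + ψ ψ̄_x` is the real number `2 Re (ψ̄ ψ_x)`. -/
def higherDensity (p p₁ p₂ : ℂ) : ℝ :=
  ‖p₂‖ ^ 2 + 3 * ‖p‖ ^ 2 * ‖p₁‖ ^ 2 + 1 / 2 * (2 * (starRingEnd ℂ p * p₁).re) ^ 2
    + 1 / 2 * ‖p‖ ^ 6

/-- The density of `Λ_c = S - c E`, where `S = R - (3 - ℰ²) Q / 2`. -/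
def lyapunovDensity (ℰ c : ℝ) (p p₁ p₂ : ℂ) : ℝ :=
  (higherDensity p p₁ p₂ - 1 / 2 * (3 - ℰ ^ 2) * chargeDensity p p₁ p₂)
    - c * energyDensity p p₁ p₂

/-- The functional `ψ ↦ ∫_I F(ψ, ψ_x, ψ_xx) dx` with density `F`. -/
def functional (F : ℂ → ℂ → ℂ → ℝ) (I : Set ℝ) (ψ : ℝ → ℂ) : ℝ :=
  ∫ x in I, F (ψ x) (deriv ψ x) (deriv (deriv ψ) x)

/-- The energy `E`. -/
def energyE (I : Set ℝ) (ψ : ℝ → ℂ) : ℝ := functional energyDensity I ψ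

/-- The charge `Q`. -/
def chargeQ (I : Set ℝ) (ψ : ℝ → ℂ) : ℝ := functional chargeDensity I ψ

/-- The higher-order energy `R`. -/
def higherR (I : Set ℝ) (ψ : ℝ → ℂ) : ℝ := functional higherDensity I ψ

/-- `S = R - (3 - ℰ²) Q / 2`. -/
def higherS (ℰ : ℝ) (I : Set ℝ) (ψ : ℝ → ℂ) : ℝ :=
  higherR I ψ - 1 / 2 * (3 - ℰ ^ 2) * chargeQ I ψ

/-- `Λ_c = S - c E`. -/
def lyapunov (ℰ c : ℝ) (I : Set ℝ) (ψ : ℝ → ℂ) : ℝ :=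
  higherS ℰ I ψ - c * energyE I ψ

/-! ### Second variations at the wave profile -/

/-- The second variation `⟨Λ_c''(u₀) w, w⟩` of `Λ_c` on the space of `T`-periodic functions:
the second derivative at `ε = 0` of `ε ↦ Λ_c(u₀ + ε w)`, with integrals over `(0, T)`. -/
def secondVariationPer (ℰ c T : ℝ) (w : ℝ → ℂ) : ℝ :=
  iteratedDeriv 2 (fun ε : ℝ => lyapunov ℰ c (Ioo 0 T) (fun x => wave ℰ x + ε * w x)) 0

/-- The bilinear form `⟨Λ_c''(u₀) w, φ⟩` over the whole line. As `Λ_c(u₀)` itself diverges on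
the line, the second derivative at `u₀` in the directions `w`, `φ` is taken in the density,
before integrating over `ℝ`. -/
def secondVariationLine (ℰ c : ℝ) (w φ : ℝ → ℂ) : ℝ :=
  ∫ x, deriv (fun s : ℝ => deriv (fun t : ℝ =>
    lyapunovDensity ℰ c
      (wave ℰ x + s * w x + t * φ x)
      (deriv (wave ℰ) x + s * deriv w x + t * deriv φ x)
      (deriv (deriv (wave ℰ)) x + s * deriv (deriv w) x + t * deriv (deriv φ) x)) 0) 0

/-- The real span of the two neutral directions `u₀'` (translations) and `i u₀` (phase
rotations). -/
def IsNeutral (ℰ : ℝ) (w : ℝ → ℂ) : Prop :=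
  ∃ a b : ℝ, ∀ x, w x = a * deriv (wave ℰ) x + b * (Complex.I * wave ℰ x)

end CnoidalNLS

end

/-! Write `U` for the profile and `V = U'`. Since `U` is real, the second variation splits into a
form in `Re w` and a form in `Im w`. For `c = 2` each is, up to a total derivative, a sum of two
squares `(P f)² + (Z f)²`, with `P` of order two, `Z` of order one and periodic coefficients. For
`Im w`, `P f = f'' + (1 - U²) f` is the operator of the profile equation and `Z f = U f' - V f` is
the Wronskian with `U`. For `Re w`, `Z f = (V f' - V' f) / (1 - U²)` is a weighted Wronskian with
`V`, and `P f = f'' + (1 - 3U²) f + U Z f` is the linearised operator corrected by `Z`. The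
denominator is harmless because `1 - U² ≥ ℰ > 0`. The identities (`plusForm_form`, `minusForm_form`)
follow from `U'' = U³ - U` and the first integral `V² = ((1 - U²)² - ℰ²) / 2`.

The total derivative integrates to zero for periodic functions, for `H²` functions and against
compactly supported ones, so the form is nonnegative in the first two settings. If both squares
vanish, `P f = 0` leaves two free constants, and `Z f = 0` at the origin, where `U = 0 ≠ V`, removes
one: `f` is a multiple of `V`, respectively of `U` (`exists_eq_mul_V`, `exists_eq_mul_U`). Such
functions are periodic, hence not in `L²(ℝ)` unless zero.

A bounded zero mode need not be integrable, so the third claim is a Liouville theorem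
(`ae_sq_eq_zero_of_bounded_weak`). The weak equation is tested against `η⁴ f` with a cutoff `η` at
scale `R`; such a test function is only `H²`, and du Bois-Reymond's lemma makes it admissible. The
errors have size `R⁻²` on an interval of length of order `R`, so the integral of the squares over
`(-R, R)` is `O(1/R)`, and both squares vanish almost everywhere. -/

namespace CnoidalNLS

/-! ### Elliptic integral, amplitude and their periodicity. -/

section Elliptic

variable {k : ℝ}

lemma one_sub_sq_mul_sin_sq_pos (hk : k ^ 2 < 1) (θ : ℝ) : 0 < 1 - k ^ 2 * Real.sin θ ^ 2 := by
  nlinarith [Real.sin_sq_le_one θ, sq_nonneg k, sq_nonneg (Real.sin θ)]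

lemma continuous_ellipticF_integrand (hk : k ^ 2 < 1) :
    Continuous fun θ : ℝ => 1 / √(1 - k ^ 2 * Real.sin θ ^ 2) := by
  refine continuous_const.div (by fun_prop) fun θ => ?_
  exact (Real.sqrt_pos.2 (one_sub_sq_mul_sin_sq_pos hk θ)).ne'

lemma hasDerivAt_ellipticF (hk : k ^ 2 < 1) (φ : ℝ) :
    HasDerivAt (ellipticF k) (1 / √(1 - k ^ 2 * Real.sin φ ^ 2)) φ :=
  intervalIntegral.integral_hasDerivAt_right
    ((continuous_ellipticF_integrand hk).intervalIntegrable _ _)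
    ((continuous_ellipticF_integrand hk).stronglyMeasurableAtFilter _ _)
    (continuous_ellipticF_integrand hk).continuousAt

lemma one_le_ellipticF_integrand (hk : k ^ 2 < 1) (θ : ℝ) :
    1 ≤ 1 / √(1 - k ^ 2 * Real.sin θ ^ 2) := by
  have h := one_sub_sq_mul_sin_sq_pos hk θ
  rw [le_div_iff₀ (Real.sqrt_pos.2 h), one_mul, Real.sqrt_le_one]
  nlinarith [sq_nonneg (k * Real.sin θ)]

lemma strictMono_ellipticF (hk : k ^ 2 < 1) : StrictMono (ellipticF k) :=
  strictMono_of_hasDerivAt_pos (hasDerivAt_ellipticF hk) fun θ =>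
    zero_lt_one.trans_le (one_le_ellipticF_integrand hk θ)

lemma continuous_ellipticF (hk : k ^ 2 < 1) : Continuous (ellipticF k) :=
  continuous_iff_continuousAt.2 fun φ => (hasDerivAt_ellipticF hk φ).continuousAt

@[simp] lemma ellipticF_zero : ellipticF k 0 = 0 := by simp [ellipticF]

lemma monotone_ellipticF_sub_id (hk : k ^ 2 < 1) : Monotone fun φ => ellipticF k φ - φ :=
  monotone_of_hasDerivAt_nonneg (fun φ => (hasDerivAt_ellipticF hk φ).sub (hasDerivAt_id φ))
    fun φ => by simpa using one_le_ellipticF_integrand hk φ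

/-- The integrand is at least `1`, so `F(φ) - φ` is increasing and vanishes at `0`; comparison with
the identity gives both limits at infinity. -/
lemma surjective_ellipticF (hk : k ^ 2 < 1) : Function.Surjective (ellipticF k) := by
  have hm := monotone_ellipticF_sub_id hk
  refine (continuous_ellipticF hk).surjective ?_ ?_
  · refine Filter.tendsto_atTop_mono' _ ?_ Filter.tendsto_id
    filter_upwards [Filter.eventually_ge_atTop 0] with φ hφ
    have := hm hφ
    simp at this
    simpa using this
  · refine Filter.tendsto_atBot_mono' _ ?_ Filter.tendsto_id
    filter_upwards [Filter.eventually_le_atBot 0] with φ hφ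
    have := hm hφ
    simp at this
    simpa using this

lemma ellipticF_jacobiAm (hk : k ^ 2 < 1) (ξ : ℝ) : ellipticF k (jacobiAm k ξ) = ξ :=
  Function.invFun_eq (surjective_ellipticF hk ξ)

lemma jacobiAm_ellipticF (hk : k ^ 2 < 1) (φ : ℝ) : jacobiAm k (ellipticF k φ) = φ :=
  Function.leftInverse_invFun (strictMono_ellipticF hk).injective φ

/-- A monotone surjection of the line has no jumps. Continuity is needed before the inverse function
rule can be applied. -/
lemma continuous_jacobiAm (hk : k ^ 2 < 1) : Continuous (jacobiAm k) := by
  have hmono : StrictMono (jacobiAm k) := by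
    intro a b hab
    rw [← (strictMono_ellipticF hk).lt_iff_lt, ellipticF_jacobiAm hk, ellipticF_jacobiAm hk]
    exact hab
  exact hmono.monotone.continuous_of_surjective fun φ => ⟨_, jacobiAm_ellipticF hk φ⟩

lemma hasDerivAt_jacobiAm (hk : k ^ 2 < 1) (ξ : ℝ) :
    HasDerivAt (jacobiAm k) √(1 - k ^ 2 * Real.sin (jacobiAm k ξ) ^ 2) ξ := by
  have h := HasDerivAt.of_local_left_inverse (continuous_jacobiAm hk).continuousAt
    (hasDerivAt_ellipticF hk (jacobiAm k ξ))
    (zero_lt_one.trans_le (one_le_ellipticF_integrand hk _)).ne'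
    (Filter.Eventually.of_forall (ellipticF_jacobiAm hk))
  simpa using h

lemma ellipticF_neg (φ : ℝ) : ellipticF k (-φ) = -ellipticF k φ := by
  have h := intervalIntegral.integral_comp_neg (a := 0) (b := φ)
    fun θ : ℝ => 1 / √(1 - k ^ 2 * Real.sin θ ^ 2)
  simp only [Real.sin_neg, neg_sq, neg_zero] at h
  rw [ellipticF, intervalIntegral.integral_symm, ← h, ellipticF]

/-- The integrand has period `π` and its primitive is odd, so a full period contributes twice the
quarter-period integral `K`. -/
lemma ellipticF_add_pi (hk : k ^ 2 < 1) (φ : ℝ) :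
    ellipticF k (φ + Real.pi) = ellipticF k φ + 2 * ellipticK k := by
  have hintegral := fun a b =>
    (continuous_ellipticF_integrand hk).intervalIntegrable (μ := volume) a b
  have hper : Function.Periodic (fun θ : ℝ => 1 / √(1 - k ^ 2 * Real.sin θ ^ 2)) Real.pi := by
    intro θ; simp [Real.sin_add_pi]
  have h1 : ellipticF k (φ + Real.pi) - ellipticF k φ
      = ∫ θ in φ..(φ + Real.pi), 1 / √(1 - k ^ 2 * Real.sin θ ^ 2) :=
    intervalIntegral.integral_interval_sub_left (hintegral _ _) (hintegral _ _)
  have h2 : ellipticF k (Real.pi / 2) - ellipticF k (-(Real.pi / 2))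
      = ∫ θ in (-(Real.pi / 2))..(Real.pi / 2), 1 / √(1 - k ^ 2 * Real.sin θ ^ 2) :=
    intervalIntegral.integral_interval_sub_left (hintegral _ _) (hintegral _ _)
  have h3 := hper.intervalIntegral_add_eq φ (-(Real.pi / 2))
  rw [show -(Real.pi / 2) + Real.pi = Real.pi / 2 by ring] at h3
  rw [ellipticF_neg] at h2
  rw [ellipticK]
  linarith

lemma ellipticK_pos (hk : k ^ 2 < 1) : 0 < ellipticK k := by
  have := strictMono_ellipticF hk (show (0 : ℝ) < Real.pi / 2 by positivity)
  simpa [ellipticK] using this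

lemma jacobiAm_add_four_ellipticK (hk : k ^ 2 < 1) (ξ : ℝ) :
    jacobiAm k (ξ + 4 * ellipticK k) = jacobiAm k ξ + 2 * Real.pi := by
  apply (strictMono_ellipticF hk).injective
  rw [ellipticF_jacobiAm hk,
    show jacobiAm k ξ + 2 * Real.pi = jacobiAm k ξ + Real.pi + Real.pi by ring,
    ellipticF_add_pi hk, ellipticF_add_pi hk, ellipticF_jacobiAm hk]
  ring

lemma jacobiAm_zero (hk : k ^ 2 < 1) : jacobiAm k 0 = 0 := by
  simpa using jacobiAm_ellipticF hk 0

end Elliptic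

/-- The analytic properties of the profile `U` with derivative `V` used in the sequel. -/
structure IsCnoidal (e T : ℝ) (U V : ℝ → ℝ) : Prop where
  pos : 0 < e
  lt_one : e < 1
  period_pos : 0 < T
  hasDerivAt : ∀ x, HasDerivAt U (V x) x
  hasDerivAt' : ∀ x, HasDerivAt V (U x ^ 3 - U x) x
  first_integral : ∀ x, V x ^ 2 = ((1 - U x ^ 2) ^ 2 - e ^ 2) / 2
  le : ∀ x, e ≤ 1 - U x ^ 2
  zero : U 0 = 0
  periodic : Function.Periodic U T
  periodic' : Function.Periodic V T

/-- The derivative of the profile. -/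
noncomputable def profileDeriv (ℰ x : ℝ) : ℝ :=
  √(1 - ℰ) * √((1 + ℰ) / 2) * (Real.cos (jacobiAm (modulus ℰ) (x * √((1 + ℰ) / 2))) *
    √(1 - modulus ℰ ^ 2 * Real.sin (jacobiAm (modulus ℰ) (x * √((1 + ℰ) / 2))) ^ 2))

lemma modulus_sq {ℰ : ℝ} (h₀ : 0 < ℰ) (h₁ : ℰ < 1) : modulus ℰ ^ 2 = (1 - ℰ) / (1 + ℰ) :=
  Real.sq_sqrt (div_nonneg (by linarith) (by linarith))

/-- The amplitude `A` and the frequency `κ` enter only through `k² κ² = A² / 2` and `k² κ² + κ² =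
1`, which turn the differential equation of `sn` into `U'' = U³ - U`. -/
lemma isCnoidal_profile {ℰ : ℝ} (h₀ : 0 < ℰ) (h₁ : ℰ < 1) :
    IsCnoidal ℰ (period ℰ) (profile ℰ) (profileDeriv ℰ) := by
  have hksq := modulus_sq h₀ h₁
  have hk : modulus ℰ ^ 2 < 1 := by
    rw [hksq, div_lt_one (by linarith)]; linarith
  set k := modulus ℰ with hkdef
  set κ := √((1 + ℰ) / 2) with hκ
  have hκsq : κ ^ 2 = (1 + ℰ) / 2 := Real.sq_sqrt (by linarith)
  have hκpos : 0 < κ := Real.sqrt_pos.2 (by linarith)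
  set A := √(1 - ℰ) with hA
  have hAsq : A ^ 2 = 1 - ℰ := Real.sq_sqrt (by linarith)
  have hkκ : k ^ 2 * κ ^ 2 = A ^ 2 / 2 := by
    rw [hksq, hκsq, hAsq]; field_simp
  have ham : ∀ x, HasDerivAt (fun x => jacobiAm k (x * κ))
      (√(1 - k ^ 2 * Real.sin (jacobiAm k (x * κ)) ^ 2) * κ) x := fun x => by
    have h := (hasDerivAt_jacobiAm hk (x * κ)).comp x ((hasDerivAt_id' x).mul_const κ)
    rw [one_mul] at h
    exact h
  -- A shift of `x` by the period shifts the elliptic argument by exactly `4 K`, hence the amplitude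
  -- by `2 π`.
  have hinv : κ * √(2 / (1 + ℰ)) = 1 := by
    rw [hκ, ← Real.sqrt_mul (by linarith)]
    rw [show (1 + ℰ) / 2 * (2 / (1 + ℰ)) = 1 by field_simp, Real.sqrt_one]
  have hper : ∀ x, jacobiAm k ((x + period ℰ) * κ) = jacobiAm k (x * κ) + 2 * Real.pi := fun x => by
    rw [← jacobiAm_add_four_ellipticK hk]
    congr 1
    rw [period, ← hkdef]
    linear_combination (4 * ellipticK k) * hinv
  have hU : ∀ x, profile ℰ x = A * Real.sin (jacobiAm k (x * κ)) := fun x => rfl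
  have hV : ∀ x, profileDeriv ℰ x = A * κ * (Real.cos (jacobiAm k (x * κ)) *
    √(1 - k ^ 2 * Real.sin (jacobiAm k (x * κ)) ^ 2)) := fun x => rfl
  have hroot : ∀ x, √(1 - k ^ 2 * Real.sin (jacobiAm k (x * κ)) ^ 2) ^ 2
      = 1 - k ^ 2 * Real.sin (jacobiAm k (x * κ)) ^ 2 := fun x =>
    Real.sq_sqrt (one_sub_sq_mul_sin_sq_pos hk _).le
  refine ⟨h₀, h₁, ?_, fun x => ?_, fun x => ?_, fun x => ?_, fun x => ?_, ?_, fun x => ?_,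
    fun x => ?_⟩
  · exact mul_pos (mul_pos four_pos (Real.sqrt_pos.2 (div_pos two_pos (by linarith))))
      (ellipticK_pos hk)
  · rw [hV]
    have := ((ham x).sin).const_mul A
    refine this.congr_deriv ?_
    ring
  · have hs := (one_sub_sq_mul_sin_sq_pos hk (jacobiAm k (x * κ)))
    have h1 := ((((ham x).sin.pow 2).const_mul (k ^ 2)).const_sub 1).sqrt hs.ne'
    have h2 := ((ham x).cos.mul h1).const_mul (A * κ)
    refine h2.congr_deriv ?_
    rw [hU]
    have hr := hroot x
    have hr0 : √(1 - k ^ 2 * Real.sin (jacobiAm k (x * κ)) ^ 2) ≠ 0 := (Real.sqrt_pos.2 hs).ne'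
    have hc := Real.sin_sq_add_cos_sq (jacobiAm k (x * κ))
    simp only [Pi.pow_apply]
    set S := Real.sin (jacobiAm k (x * κ))
    set C := Real.cos (jacobiAm k (x * κ))
    set D := √(1 - k ^ 2 * S ^ 2)
    have hC : C ^ 2 = 1 - S ^ 2 := by linarith
    have hone : k ^ 2 * κ ^ 2 + κ ^ 2 = 1 := by rw [hkκ, hκsq, hAsq]; ring
    -- The square root produced by differentiating `√(1 - k² sin²)` cancels against the one in the
    -- derivative of the amplitude.
    have hq : -(k ^ 2 * (((2 : ℕ) : ℝ) * S ^ (2 - 1) * (C * (D * κ)))) / (2 * D)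
        = -(k ^ 2 * S * C * κ) := by
      push_cast
      field_simp
    rw [hq]
    linear_combination (-A * κ ^ 2 * S) * hr + (-A * κ ^ 2 * k ^ 2 * S) * hC - A * S * hone
      + 2 * A * S ^ 3 * hkκ
  · rw [hU, hV]
    have hr := hroot x
    have hc := Real.sin_sq_add_cos_sq (jacobiAm k (x * κ))
    set S := Real.sin (jacobiAm k (x * κ))
    set C := Real.cos (jacobiAm k (x * κ))
    have hC : C ^ 2 = 1 - S ^ 2 := by linarith
    rw [mul_pow, mul_pow, mul_pow, hr, hC, mul_pow, hAsq, hκsq, hksq]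
    field_simp
    ring
  · rw [hU, mul_pow, hAsq]
    nlinarith [Real.sin_sq_le_one (jacobiAm k (x * κ))]
  · rw [hU]; simp [jacobiAm_zero hk]
  · rw [hU, hU, hper, Real.sin_add_two_pi]
  · rw [hV, hV, hper, Real.sin_add_two_pi, Real.cos_add_two_pi]

/-! ### Locally absolutely continuous functions. -/

lemma intervalIntegrable_of_locallyIntegrable {f : ℝ → ℝ} (hf : LocallyIntegrable f) (a b : ℝ) :
    IntervalIntegrable f volume a b :=
  intervalIntegrable_iff.mpr <|
    (hf.integrableOn_isCompact isCompact_uIcc).mono_set uIoc_subset_uIcc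

/-- A nonnegative locally integrable function with vanishing integrals over arbitrarily large
symmetric intervals vanishes almost everywhere. -/
lemma ae_eq_zero_of_integral_le_zero {h : ℝ → ℝ} (hloc : LocallyIntegrable h) (h0 : ∀ x, 0 ≤ h x)
    (hintegral : ∀ r : ℝ, ∃ R, r ≤ R ∧ ∫ x in -R..R, h x ≤ 0) : ∀ᵐ x, h x = 0 := by
  have key : ∀ n : ℕ, ∀ᵐ x, x ∈ Ioc (-(n : ℝ)) n → h x = 0 := by
    intro n
    obtain ⟨R, hnR, hR⟩ := hintegral n
    have hn : (0 : ℝ) ≤ n := n.cast_nonneg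
    rw [intervalIntegral.integral_of_le (by linarith)] at hR
    have hI : IntegrableOn h (Ioc (-R) R) :=
      (intervalIntegrable_iff_integrableOn_Ioc_of_le (by linarith)).1
        (intervalIntegrable_of_locallyIntegrable hloc (-R) R)
    have := (integral_eq_zero_iff_of_nonneg (fun x => h0 x) hI).1
      (le_antisymm hR (integral_nonneg fun x => h0 x))
    have := (ae_restrict_iff' measurableSet_Ioc).1 this
    filter_upwards [this] with x hx hxn
    exact hx ⟨by linarith [hxn.1], by linarith [hxn.2]⟩
  filter_upwards [ae_all_iff.2 key] with x hx
  obtain ⟨n, hn⟩ := exists_nat_gt |x|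
  have := abs_lt.1 hn
  exact hx n ⟨this.1, this.2.le⟩

/-- `F` is a locally absolutely continuous function with almost everywhere derivative `f`. -/
structure IsPrim (F f : ℝ → ℝ) : Prop where
  loc : LocallyIntegrable f
  ftc : ∀ a b : ℝ, ∫ x in a..b, f x = F b - F a

namespace IsPrim

variable {F f G g : ℝ → ℝ}

lemma eq_add (h : IsPrim F f) (a : ℝ) : F = fun x => (∫ t in a..x, f t) + F a := by
  funext x; rw [h.ftc]; ring

lemma ae_hasDerivAt (h : IsPrim F f) : ∀ᵐ x, HasDerivAt F (f x) x := by
  filter_upwards [LocallyIntegrable.ae_hasDerivAt_integral h.loc] with x hx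
  rw [h.eq_add 0]
  exact (hx 0).add_const _

lemma continuous (h : IsPrim F f) : Continuous F := by
  rw [h.eq_add 0]
  exact (intervalIntegral.continuous_primitive
    (intervalIntegrable_of_locallyIntegrable h.loc) 0).add continuous_const

lemma absolutelyContinuousOnInterval (h : IsPrim F f) (a b : ℝ) :
    AbsolutelyContinuousOnInterval F a b := by
  have h1 := (intervalIntegrable_of_locallyIntegrable h.loc a b
    ).absolutelyContinuousOnInterval_intervalIntegral (c := a) (by simp)
  have h2 : AbsolutelyContinuousOnInterval (fun _ : ℝ => F a) a b :=
    (contDiff_const (n := 1)).contDiffOn.absolutelyContinuousOnInterval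
  rw [h.eq_add a]
  exact h1.add h2

lemma of_hasDerivAt (h : ∀ x, HasDerivAt F (f x) x) (hf : Continuous f) : IsPrim F f :=
  ⟨hf.locallyIntegrable, fun a b => intervalIntegral.integral_eq_sub_of_hasDerivAt
    (fun x _ => h x) (hf.intervalIntegrable a b)⟩

lemma integral {f : ℝ → ℝ} (hf : LocallyIntegrable f) :
    IsPrim (fun x => ∫ t in (0 : ℝ)..x, f t) f :=
  ⟨hf, fun _ _ => (intervalIntegral.integral_interval_sub_left
    (intervalIntegrable_of_locallyIntegrable hf _ _)
    (intervalIntegrable_of_locallyIntegrable hf _ _)).symm⟩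

lemma add (hF : IsPrim F f) (hG : IsPrim G g) :
    IsPrim (fun x => F x + G x) (fun x => f x + g x) :=
  ⟨hF.loc.add hG.loc, fun a b => by
    rw [intervalIntegral.integral_add (intervalIntegrable_of_locallyIntegrable hF.loc a b)
      (intervalIntegrable_of_locallyIntegrable hG.loc a b), hF.ftc, hG.ftc]
    ring⟩

/-- Integration by parts for absolutely continuous functions. Nothing stronger is available for the
first derivative of an `H²` function. -/
lemma mul (hF : IsPrim F f) (hG : IsPrim G g) :
    IsPrim (fun x => F x * G x) (fun x => f x * G x + F x * g x) := by
  refine ⟨(hF.loc.mul_continuous hG.continuous).add (hG.loc.continuous_mul hF.continuous),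
    fun a b => ?_⟩
  rw [← (hF.absolutelyContinuousOnInterval a b).integral_deriv_mul_eq_sub
    (hG.absolutelyContinuousOnInterval a b)]
  apply intervalIntegral.integral_congr_ae
  filter_upwards [hF.ae_hasDerivAt, hG.ae_hasDerivAt] with x hx hx' _
  rw [hx.deriv, hx'.deriv]

lemma congr (hF : IsPrim F f) (h : ∀ x, G x = F x) (h' : ∀ x, g x = f x) : IsPrim G g := by
  obtain rfl : G = F := funext h
  obtain rfl : g = f := funext h'
  exact hF

/-- The integral over the line of the derivative of an integrable function vanishes. -/
lemma integral_eq_zero (hF : IsPrim F f) (hFi : Integrable F) (hfi : Integrable f) :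
    ∫ x, f x = 0 := by
  have h1 := intervalIntegral_tendsto_integral hfi Filter.tendsto_neg_atTop_atBot Filter.tendsto_id
  simp only [hF.ftc, id] at h1
  -- `F x - F (-x)` converges to the integral of `f` and is itself integrable; a nonzero limit is
  -- impossible because neighbourhoods of infinity have infinite measure.
  have h2 : Integrable fun x => F x - F (-x) := hFi.sub hFi.comp_neg
  refine IntegrableAtFilter.eq_zero_of_tendsto (l := Filter.atTop) (μ := volume)
    ⟨univ, Filter.univ_mem, h2.integrableOn⟩ ?_ h1
  intro s hs
  obtain ⟨a, ha⟩ := Filter.mem_atTop_sets.1 hs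
  refine top_unique ?_
  rw [← Real.volume_Ici (a := a)]
  exact measure_mono ha

end IsPrim

/-! ### Quadratic forms that are sums of squares up to a total derivative. -/

/-- A real function of class `H²_loc` together with its first two derivatives. -/
structure H2Jet where
  f₀ : ℝ → ℝ
  f₁ : ℝ → ℝ
  f₂ : ℝ → ℝ
  hasDerivAt : ∀ x, HasDerivAt f₀ (f₁ x) x
  prim : IsPrim f₁ f₂
  sq : LocallyIntegrable fun x => f₂ x ^ 2

namespace H2Jet

lemma continuous_zero (f : H2Jet) : Continuous f.f₀ :=
  continuous_iff_continuousAt.2 fun x => (f.hasDerivAt x).continuousAt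

lemma continuous_one (f : H2Jet) : Continuous f.f₁ := f.prim.continuous

lemma prim_zero (f : H2Jet) : IsPrim f.f₀ f.f₁ := .of_hasDerivAt f.hasDerivAt f.continuous_one

/-- The jet of a function of class `C²`. -/
@[simps] def ofContinuous (f₀ f₁ f₂ : ℝ → ℝ) (h₁ : ∀ x, HasDerivAt f₀ (f₁ x) x)
    (h₂ : ∀ x, HasDerivAt f₁ (f₂ x) x) (hc : Continuous f₂) : H2Jet where
  f₀ := f₀
  f₁ := f₁
  f₂ := f₂
  hasDerivAt := h₁
  prim := .of_hasDerivAt h₂ hc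
  sq := (hc.pow 2).locallyIntegrable

end H2Jet

lemma locallyIntegrable_mul {f g : ℝ → ℝ} (hf : LocallyIntegrable f) (hg : LocallyIntegrable g)
    (hf2 : LocallyIntegrable fun x => f x ^ 2) (hg2 : LocallyIntegrable fun x => g x ^ 2) :
    LocallyIntegrable fun x => f x * g x := by
  refine (hf2.add hg2).mono (hf.aestronglyMeasurable.mul hg.aestronglyMeasurable) ?_
  refine Filter.Eventually.of_forall fun x => ?_
  simp only [Pi.add_apply, Real.norm_eq_abs]
  rw [abs_of_nonneg (a := f x ^ 2 + g x ^ 2) (by positivity), abs_le]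
  constructor <;> nlinarith [sq_nonneg (f x + g x), sq_nonneg (f x - g x), sq_nonneg (f x),
    sq_nonneg (g x)]

/-- The coefficients of a pair of operators `P f = f'' + g f' + q f`, `Z f = r f' + s f`, and of
a boundary term, all periodic. -/
structure SquareForm where
  T : ℝ
  g : ℝ → ℝ
  q : ℝ → ℝ
  r : ℝ → ℝ
  s : ℝ → ℝ
  γ : ℝ → ℝ
  g' : ℝ → ℝ
  q' : ℝ → ℝ
  γ' : ℝ → ℝ
  T_pos : 0 < T
  hg : ∀ x, HasDerivAt g (g' x) x
  hq : ∀ x, HasDerivAt q (q' x) x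
  hγ : ∀ x, HasDerivAt γ (γ' x) x
  cont_g' : Continuous g'
  cont_q' : Continuous q'
  cont_γ' : Continuous γ'
  cont_r : Continuous r
  cont_s : Continuous s
  per_g : Function.Periodic g T
  per_q : Function.Periodic q T
  per_r : Function.Periodic r T
  per_s : Function.Periodic s T
  per_γ : Function.Periodic γ T

namespace SquareForm

variable (F : SquareForm)

lemma cont_g : Continuous F.g := continuous_iff_continuousAt.2 fun x => (F.hg x).continuousAt

lemma cont_q : Continuous F.q := continuous_iff_continuousAt.2 fun x => (F.hq x).continuousAt

lemma cont_γ : Continuous F.γ := continuous_iff_continuousAt.2 fun x => (F.hγ x).continuousAt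

/-- The second-order operator `P f = f'' + g f' + q f`. -/
def P (f : H2Jet) (x : ℝ) : ℝ := f.f₂ x + F.g x * f.f₁ x + F.q x * f.f₀ x

/-- The first-order operator `Z f = r f' + s f`. -/
def Z (f : H2Jet) (x : ℝ) : ℝ := F.r x * f.f₁ x + F.s x * f.f₀ x

/-- The density `P f · P h + Z f · Z h`. -/
def sq (f h : H2Jet) (x : ℝ) : ℝ := F.P f x * F.P h x + F.Z f x * F.Z h x

/-- The density which differs from `sq` by the derivative of the boundary term. -/
def form (f h : H2Jet) (x : ℝ) : ℝ :=
  f.f₂ x * h.f₂ x + (F.g x ^ 2 + F.r x ^ 2 - F.g' x - 2 * F.q x) * (f.f₁ x * h.f₁ x)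
    + (F.g x * F.q x + F.r x * F.s x + F.γ x - F.q' x) * (f.f₀ x * h.f₁ x + f.f₁ x * h.f₀ x)
    + (F.q x ^ 2 + F.s x ^ 2 + F.γ' x) * (f.f₀ x * h.f₀ x)

/-- The boundary term. -/
def bdry (f h : H2Jet) (x : ℝ) : ℝ :=
  F.γ x * (f.f₀ x * h.f₀ x) - F.q x * (f.f₁ x * h.f₀ x + f.f₀ x * h.f₁ x)
    - F.g x * (f.f₁ x * h.f₁ x)

/-- Expanding the squares produces `g (f'' h' + f' h'')` and `q (f'' h + f h'')`; both are
integrated by parts, which lowers their order and creates `-g'`, `-2 q` and `-q'`. The function `γ`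
is the remaining freedom: adding the derivative of `γ f h` shifts weight between the two lowest
orders. -/
lemma isPrim_bdry (f h : H2Jet) : IsPrim (F.bdry f h) fun x => F.form f h x - F.sq f h x := by
  have pg := IsPrim.of_hasDerivAt (fun x => (F.hg x).neg) F.cont_g'.neg
  have pq := IsPrim.of_hasDerivAt (fun x => (F.hq x).neg) F.cont_q'.neg
  have pγ := IsPrim.of_hasDerivAt F.hγ F.cont_γ'
  refine ((pγ.mul (f.prim_zero.mul h.prim_zero)).add
    ((pq.mul ((f.prim.mul h.prim_zero).add (f.prim_zero.mul h.prim))).add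
      (pg.mul (f.prim.mul h.prim)))).congr (fun x => ?_) (fun x => ?_)
  · simp only [bdry, Pi.neg_apply]; ring
  · simp only [form, sq, P, Z, Pi.neg_apply]; ring

lemma continuous_Z (f : H2Jet) : Continuous (F.Z f) :=
  (F.cont_r.mul f.continuous_one).add (F.cont_s.mul f.continuous_zero)

lemma loc_P (f : H2Jet) : LocallyIntegrable (F.P f) :=
  (f.prim.loc.add (F.cont_g.mul f.continuous_one).locallyIntegrable).add
    (F.cont_q.mul f.continuous_zero).locallyIntegrable

lemma loc_P_sq (f : H2Jet) : LocallyIntegrable fun x => F.P f x ^ 2 := by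
  have hc : Continuous fun x => F.g x * f.f₁ x + F.q x * f.f₀ x :=
    (F.cont_g.mul f.continuous_one).add (F.cont_q.mul f.continuous_zero)
  have hc2 : Continuous fun x => 2 * (F.g x * f.f₁ x + F.q x * f.f₀ x) := continuous_const.mul hc
  have := (f.sq.add (f.prim.loc.continuous_mul hc2)).add
    (hc.pow 2).locallyIntegrable
  refine this.congr (Filter.Eventually.of_forall fun x => ?_)
  simp only [P, Pi.add_apply, Pi.pow_apply]
  ring

lemma loc_sq (f h : H2Jet) : LocallyIntegrable (F.sq f h) :=
  (locallyIntegrable_mul (F.loc_P f) (F.loc_P h) (F.loc_P_sq f) (F.loc_P_sq h)).add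
    ((F.continuous_Z f).mul (F.continuous_Z h)).locallyIntegrable

lemma loc_form (f h : H2Jet) : LocallyIntegrable (F.form f h) := by
  refine ((F.loc_sq f h).add (F.isPrim_bdry f h).loc).congr
    (Filter.Eventually.of_forall fun x => ?_)
  simp

lemma sq_self_nonneg (f : H2Jet) (x : ℝ) : 0 ≤ F.sq f f x :=
  add_nonneg (mul_self_nonneg _) (mul_self_nonneg _)

lemma sq_self_eq_zero {f : H2Jet} {x : ℝ} (h : F.sq f f x = 0) : F.P f x = 0 ∧ F.Z f x = 0 := by
  have h1 := mul_self_nonneg (F.P f x)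
  have h2 := mul_self_nonneg (F.Z f x)
  unfold sq at h
  exact ⟨mul_self_eq_zero.1 (by linarith), mul_self_eq_zero.1 (by linarith)⟩

lemma integral_form_of_bdry_eq {f h : H2Jet} {a b : ℝ} (hab : F.bdry f h b = F.bdry f h a) :
    ∫ x in a..b, F.form f h x = ∫ x in a..b, F.sq f h x := by
  have := (F.isPrim_bdry f h).ftc a b
  rw [intervalIntegral.integral_sub (intervalIntegrable_of_locallyIntegrable (F.loc_form f h) a b)
    (intervalIntegrable_of_locallyIntegrable (F.loc_sq f h) a b)] at this
  linarith

/-- The form on functions whose period is a multiple of that of the coefficients. -/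
lemma integral_form_periodic (f : H2Jet) (N : ℕ) (h0 : Function.Periodic f.f₀ (N * F.T))
    (h1 : Function.Periodic f.f₁ (N * F.T)) :
    ∫ x in 0..(N * F.T), F.form f f x = ∫ x in 0..(N * F.T), F.sq f f x := by
  apply F.integral_form_of_bdry_eq
  have := h0 0
  have := h1 0
  have := F.per_g.nat_mul N 0
  have := F.per_q.nat_mul N 0
  have := F.per_γ.nat_mul N 0
  simp only [zero_add] at *
  simp only [bdry, *]

/-- `f` and its derivatives vanish outside `(-R, R)`. -/
def VanishesOutside (f : H2Jet) (R : ℝ) : Prop :=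
  ∀ x, R ≤ |x| → f.f₀ x = 0 ∧ f.f₁ x = 0 ∧ f.f₂ x = 0

lemma integral_eq_intervalIntegral {k : ℝ → ℝ} {R : ℝ} (h : ∀ x, R ≤ |x| → k x = 0) :
    ∫ x, k x = ∫ x in -R..R, k x := by
  refine (intervalIntegral.integral_eq_integral_of_support_subset fun x hx => ?_).symm
  have : |x| < R := not_le.1 fun hR => hx (h x hR)
  exact ⟨(abs_lt.1 this).1, (abs_lt.1 this).2.le⟩

/-- The form tested against a compactly supported function. -/
lemma integral_form_compact (f h : H2Jet) {R : ℝ} (hh : VanishesOutside h R) :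
    ∫ x, F.form f h x = ∫ x, F.sq f h x := by
  have hv : ∀ x, R ≤ |x| → F.bdry f h x = 0 := fun x hx => by
    obtain ⟨h0, h1, h2⟩ := hh x hx
    simp [bdry, h0, h1]
  rw [integral_eq_intervalIntegral (R := R), integral_eq_intervalIntegral (R := R),
    F.integral_form_of_bdry_eq]
  · rw [hv R (le_abs_self R), hv (-R) (by rw [abs_neg]; exact le_abs_self R)]
  · intro x hx
    obtain ⟨h0, h1, h2⟩ := hh x hx
    simp [sq, P, Z, h0, h1, h2]
  · intro x hx
    obtain ⟨h0, h1, h2⟩ := hh x hx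
    simp [form, h0, h1, h2]

end SquareForm

lemma exists_bound_of_periodic {f : ℝ → ℝ} {T : ℝ} (hT : 0 < T) (hf : Function.Periodic f T)
    (hc : Continuous f) : ∃ M, ∀ x, |f x| ≤ M := by
  obtain ⟨M, hM⟩ := (hf.isBounded_of_continuous hT.ne' hc).exists_norm_le
  exact ⟨M, fun x => hM _ (mem_range_self x)⟩

lemma memLp_mul_of_periodic {c f : ℝ → ℝ} {T : ℝ} (hT : 0 < T) (hc : Function.Periodic c T)
    (hcc : Continuous c) (hf : MemLp f 2) : MemLp (fun x => c x * f x) 2 := by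
  obtain ⟨M, hM⟩ := exists_bound_of_periodic hT hc hcc
  refine hf.of_le_mul (c := M) (hcc.aestronglyMeasurable.mul hf.1) ?_
  refine Filter.Eventually.of_forall fun x => ?_
  rw [norm_mul]
  exact mul_le_mul_of_nonneg_right (hM x) (norm_nonneg _)

lemma periodic_of_hasDerivAt {f f' : ℝ → ℝ} {T : ℝ} (hf : Function.Periodic f T)
    (h : ∀ x, HasDerivAt f (f' x) x) : Function.Periodic f' T := by
  intro x
  have h1 := (h (x + T)).comp_add_const x T
  rw [show (fun x => f (x + T)) = f from funext hf] at h1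
  exact h1.unique (h x)

namespace SquareForm

variable (F : SquareForm)

/-- The form on square-integrable functions. -/
lemma integral_form_memLp (f : H2Jet) (h0 : MemLp f.f₀ 2) (h1 : MemLp f.f₁ 2)
    (h2 : MemLp f.f₂ 2) :
    Integrable (F.form f f) ∧ Integrable (F.sq f f) ∧
      ∫ x, F.form f f x = ∫ x, F.sq f f x := by
  have hP : MemLp (F.P f) 2 := (h2.add (memLp_mul_of_periodic F.T_pos F.per_g F.cont_g h1)).add
    (memLp_mul_of_periodic F.T_pos F.per_q F.cont_q h0)
  have hZ : MemLp (F.Z f) 2 := (memLp_mul_of_periodic F.T_pos F.per_r F.cont_r h1).add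
    (memLp_mul_of_periodic F.T_pos F.per_s F.cont_s h0)
  have hsq : Integrable (F.sq f f) := (hP.integrable_mul hP).add (hZ.integrable_mul hZ)
  have m {c : ℝ → ℝ} (hc : Function.Periodic c F.T) (hcc : Continuous c) {u v : ℝ → ℝ}
      (hu : MemLp u 2) (hv : MemLp v 2) : Integrable fun x => c x * (u x * v x) := by
    have := (memLp_mul_of_periodic F.T_pos hc hcc hu).integrable_mul hv
    refine this.congr (Filter.Eventually.of_forall fun x => ?_)
    simp only [Pi.mul_apply]; ring
  have pg' := periodic_of_hasDerivAt F.per_g F.hg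
  have pq' := periodic_of_hasDerivAt F.per_q F.hq
  have pγ' := periodic_of_hasDerivAt F.per_γ F.hγ
  have hB : Integrable (F.bdry f f) := by
    have := ((m F.per_γ F.cont_γ h0 h0).sub ((m F.per_q F.cont_q h1 h0).add
      (m F.per_q F.cont_q h0 h1))).sub (m F.per_g F.cont_g h1 h1)
    refine this.congr (Filter.Eventually.of_forall fun x => ?_)
    simp only [bdry, Pi.add_apply, Pi.sub_apply]; ring
  have hform : Integrable (F.form f f) := by
    have c1 : Continuous fun x => F.g x ^ 2 + F.r x ^ 2 - F.g' x - 2 * F.q x := by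
      have := F.cont_g; have := F.cont_q; have := F.cont_g'; have := F.cont_r; fun_prop
    have p1 : Function.Periodic (fun x => F.g x ^ 2 + F.r x ^ 2 - F.g' x - 2 * F.q x) F.T :=
      fun x => by simp only [F.per_g x, F.per_r x, pg' x, F.per_q x]
    have c2 : Continuous fun x => F.g x * F.q x + F.r x * F.s x + F.γ x - F.q' x := by
      have := F.cont_g; have := F.cont_q; have := F.cont_q'; have := F.cont_r
      have := F.cont_s; have := F.cont_γ; fun_prop
    have p2 : Function.Periodic (fun x => F.g x * F.q x + F.r x * F.s x + F.γ x - F.q' x) F.T :=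
      fun x => by simp only [F.per_g x, F.per_r x, pq' x, F.per_q x, F.per_s x, F.per_γ x]
    have c3 : Continuous fun x => F.q x ^ 2 + F.s x ^ 2 + F.γ' x := by
      have := F.cont_q; have := F.cont_γ'; have := F.cont_s; fun_prop
    have p3 : Function.Periodic (fun x => F.q x ^ 2 + F.s x ^ 2 + F.γ' x) F.T :=
      fun x => by simp only [F.per_q x, F.per_s x, pγ' x]
    have := (((h2.integrable_mul h2).add (m p1 c1 h1 h1)).add
      ((m p2 c2 h0 h1).add (m p2 c2 h1 h0))).add (m p3 c3 h0 h0)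
    refine this.congr (Filter.Eventually.of_forall fun x => ?_)
    simp only [form, Pi.add_apply, Pi.mul_apply]; ring
  refine ⟨hform, hsq, ?_⟩
  -- No decay of the boundary term is needed: it is integrable together with its derivative.
  have := (F.isPrim_bdry f f).integral_eq_zero hB (hform.sub hsq)
  rw [integral_sub hform hsq] at this
  linarith

end SquareForm

/-! ### Test functions and du Bois-Reymond lemmas of first and second order. -/

section TestFunctions

lemma exists_forall_eq_zero_of_hasCompactSupport {E : Type*} [NormedAddCommGroup E] {ψ : ℝ → E}
    (h : HasCompactSupport ψ) : ∃ R, 0 < R ∧ ∀ x, R ≤ |x| → ψ x = 0 := by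
  obtain ⟨R, hR, hs⟩ := h.isCompact.isBounded.subset_ball_lt 0 0
  refine ⟨R, hR, fun x hx => ?_⟩
  by_contra hne
  have := hs (subset_tsupport _ hne)
  rw [Metric.mem_ball, dist_zero_right, Real.norm_eq_abs] at this
  linarith

/-- A smooth compactly supported function with vanishing integral has a compactly supported
primitive. -/
lemma exists_primitive_hasCompactSupport {ψ : ℝ → ℝ} (h : ContDiff ℝ ∞ ψ)
    (hc : HasCompactSupport ψ) (h0 : ∫ x, ψ x = 0) :
    ∃ φ : ℝ → ℝ, ContDiff ℝ ∞ φ ∧ HasCompactSupport φ ∧ deriv φ = ψ := by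
  obtain ⟨R, hR, hψ⟩ := exists_forall_eq_zero_of_hasCompactSupport hc
  have hcont := h.continuous
  have hd : ∀ x, HasDerivAt (fun x => ∫ t in -R..x, ψ t) (ψ x) x := fun x =>
    intervalIntegral.integral_hasDerivAt_right (hcont.intervalIntegrable _ _)
      (hcont.stronglyMeasurableAtFilter _ _) hcont.continuousAt
  have hderiv : deriv (fun x => ∫ t in -R..x, ψ t) = ψ := funext fun x => (hd x).deriv
  refine ⟨fun x => ∫ t in -R..x, ψ t, ?_, ?_, hderiv⟩
  · rw [contDiff_infty_iff_deriv, hderiv]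
    exact ⟨fun x => (hd x).differentiableAt, h⟩
  · refine HasCompactSupport.intro (isCompact_Icc (a := -R) (b := R)) fun x hx => ?_
    rcases lt_or_ge x (-R) with hx1 | hx1
    · rw [intervalIntegral.integral_symm, intervalIntegral.integral_congr (g := fun _ => 0)]
      · simp
      · intro t ht
        rw [uIcc_of_le hx1.le] at ht
        exact hψ t (le_abs.2 (Or.inr (by linarith [ht.2])))
    · have hx2 : R ≤ x := by
        by_contra hlt
        exact hx ⟨hx1, (not_le.1 hlt).le⟩
      rw [← h0]
      refine intervalIntegral.integral_eq_integral_of_support_subset fun t ht => ?_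
      have : |t| < R := not_le.1 fun hR => ht (hψ t hR)
      exact ⟨(abs_lt.1 this).1, (abs_lt.1 this).2.le.trans hx2⟩

lemma exists_contDiff_integral_eq_one :
    ∃ θ : ℝ → ℝ, ContDiff ℝ ∞ θ ∧ HasCompactSupport θ ∧ ∫ x, θ x = 1 := by
  let b : ContDiffBump (0 : ℝ) := default
  exact ⟨b.normed volume, b.contDiff_normed, b.hasCompactSupport_normed, b.integral_normed⟩

lemma integrable_mul_of_hasCompactSupport {m φ : ℝ → ℝ} (hm : LocallyIntegrable m)
    (hφ : Continuous φ) (hc : HasCompactSupport φ) : Integrable fun x => m x * φ x :=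
  hm.integrable_smul_right_of_hasCompactSupport hφ hc

/-- The lemma of du Bois-Reymond. -/
lemma ae_eq_const_of_integral_mul_deriv {m : ℝ → ℝ} (hm : LocallyIntegrable m)
    (h : ∀ φ : ℝ → ℝ, ContDiff ℝ ∞ φ → HasCompactSupport φ → ∫ x, m x * deriv φ x = 0) :
    ∃ c, ∀ᵐ x, m x = c := by
  obtain ⟨θ, hθ, hθc, hθ1⟩ := exists_contDiff_integral_eq_one
  refine ⟨∫ x, m x * θ x, ?_⟩
  set c := ∫ x, m x * θ x with hcdef
  have hmc : LocallyIntegrable fun x => m x - c := hm.sub continuous_const.locallyIntegrable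
  have := ae_eq_zero_of_integral_contDiff_smul_eq_zero hmc fun ψ hψ hψc => by
    have hψi : Integrable ψ := hψ.continuous.integrable_of_hasCompactSupport hψc
    have hθi : Integrable θ := hθ.continuous.integrable_of_hasCompactSupport hθc
    -- Subtracting `(∫ ψ) θ` makes the mean zero, so the result is the derivative of a test
    -- function.
    obtain ⟨φ, hφ, hφc, hφd⟩ := exists_primitive_hasCompactSupport
      (ψ := fun x => ψ x - (∫ y, ψ y) * θ x) (hψ.sub (contDiff_const.mul hθ))
      (hψc.sub hθc.mul_left) (by
        rw [integral_sub hψi (hθi.const_mul _), integral_const_mul, hθ1]; ring)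
    have h1 := h φ hφ hφc
    rw [hφd] at h1
    have e1 : ∀ x, m x * (ψ x - (∫ y, ψ y) * θ x) = m x * ψ x - (∫ y, ψ y) * (m x * θ x) :=
      fun x => by ring
    have i1 := integrable_mul_of_hasCompactSupport hm hψ.continuous hψc
    have i2 := integrable_mul_of_hasCompactSupport hm hθ.continuous hθc
    simp only [e1] at h1
    rw [integral_sub i1 (i2.const_mul _), integral_const_mul, ← hcdef] at h1
    have e2 : ∀ x, ψ x • (m x - c) = m x * ψ x - c * ψ x := fun x => by
      rw [smul_eq_mul]; ring
    simp only [e2]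
    rw [integral_sub i1 (hψi.const_mul _), integral_const_mul]
    linarith
  filter_upwards [this] with x hx
  linarith

lemma integral_id_mul_deriv {φ : ℝ → ℝ} (hφ : ContDiff ℝ ∞ φ) (hc : HasCompactSupport φ) :
    ∫ x, x * deriv φ x = -∫ x, φ x := by
  have hd := (contDiff_infty_iff_deriv.1 hφ)
  have := integral_mul_deriv_eq_deriv_mul_of_integrable (u := fun x : ℝ => x) (u' := fun _ => 1)
    (v := φ) (v' := deriv φ) (fun x _ => hasDerivAt_id' x) (fun x _ => (hd.1 x).hasDerivAt)
    (integrable_mul_of_hasCompactSupport continuous_id.locallyIntegrable hd.2.continuous hc.deriv)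
    (integrable_mul_of_hasCompactSupport continuous_const.locallyIntegrable hφ.continuous hc)
    (integrable_mul_of_hasCompactSupport continuous_id.locallyIntegrable hφ.continuous hc)
  simpa using this

/-- The second-order version of the lemma of du Bois-Reymond. -/
lemma ae_eq_affine_of_integral_mul_deriv_deriv {m : ℝ → ℝ} (hm : LocallyIntegrable m)
    (h : ∀ φ : ℝ → ℝ, ContDiff ℝ ∞ φ → HasCompactSupport φ →
      ∫ x, m x * deriv (deriv φ) x = 0) :
    ∃ α β : ℝ, ∀ᵐ x, m x = α + β * x := by
  obtain ⟨θ, hθ, hθc, hθ1⟩ := exists_contDiff_integral_eq_one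
  have hθd := contDiff_infty_iff_deriv.1 hθ
  -- The hypothesis gives `∫ m ψ' = -β ∫ ψ` for every test function `ψ`, and `β x` has the same
  -- pairing, so the first-order lemma applies to `m - β x`.
  set β := -∫ x, m x * deriv θ x with hβ
  have hlin : LocallyIntegrable fun x : ℝ => β * x :=
    (continuous_const.mul continuous_id).locallyIntegrable
  have hmc : LocallyIntegrable fun x => m x - β * x := hm.sub hlin
  obtain ⟨α, hα⟩ := ae_eq_const_of_integral_mul_deriv hmc fun ψ hψ hψc => by
    have hψd := contDiff_infty_iff_deriv.1 hψ
    have hψi : Integrable ψ := hψ.continuous.integrable_of_hasCompactSupport hψc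
    have hθi : Integrable θ := hθ.continuous.integrable_of_hasCompactSupport hθc
    obtain ⟨φ, hφ, hφc, hφd⟩ := exists_primitive_hasCompactSupport
      (ψ := fun x => ψ x - (∫ y, ψ y) * θ x) (hψ.sub (contDiff_const.mul hθ))
      (hψc.sub hθc.mul_left) (by
        rw [integral_sub hψi (hθi.const_mul _), integral_const_mul, hθ1]; ring)
    have h1 := h φ hφ hφc
    have hdd : deriv (deriv φ) = fun x => deriv ψ x - (∫ y, ψ y) * deriv θ x := by
      rw [hφd]
      funext x
      exact ((hψd.1 x).hasDerivAt.sub ((hθd.1 x).hasDerivAt.const_mul _)).deriv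
    rw [hdd] at h1
    have e1 : ∀ x, m x * (deriv ψ x - (∫ y, ψ y) * deriv θ x)
        = m x * deriv ψ x - (∫ y, ψ y) * (m x * deriv θ x) := fun x => by ring
    have i1 := integrable_mul_of_hasCompactSupport hm hψd.2.continuous hψc.deriv
    have i2 := integrable_mul_of_hasCompactSupport hm hθd.2.continuous hθc.deriv
    have i3 := integrable_mul_of_hasCompactSupport
      (m := fun x : ℝ => x) continuous_id.locallyIntegrable hψd.2.continuous hψc.deriv
    simp only [e1] at h1
    rw [integral_sub i1 (i2.const_mul _), integral_const_mul] at h1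
    have e2 : ∀ x, (m x - β * x) * deriv ψ x = m x * deriv ψ x - β * (x * deriv ψ x) :=
      fun x => by ring
    simp only [e2]
    rw [integral_sub i1 (i3.const_mul _), integral_const_mul, integral_id_mul_deriv hψ hψc, hβ]
    linarith
  refine ⟨α, β, ?_⟩
  filter_upwards [hα] with x hx
  linarith

/-- The jet of a smooth function. -/
noncomputable def H2Jet.ofSmooth (ψ : ℝ → ℝ) (h : ContDiff ℝ ∞ ψ) : H2Jet :=
  .ofContinuous ψ (deriv ψ) (deriv (deriv ψ))
    (fun x => ((contDiff_infty_iff_deriv.1 h).1 x).hasDerivAt)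
    (fun x => ((contDiff_infty_iff_deriv.1 (contDiff_infty_iff_deriv.1 h).2).1 x).hasDerivAt)
    (contDiff_infty_iff_deriv.1 (contDiff_infty_iff_deriv.1 h).2).2.continuous

lemma exists_vanishesOutside {f : H2Jet} (h₀ : HasCompactSupport f.f₀)
    (h₁ : HasCompactSupport f.f₁) (h₂ : HasCompactSupport f.f₂) :
    ∃ R, 0 < R ∧ SquareForm.VanishesOutside f R := by
  obtain ⟨R₀, hR₀, H₀⟩ := exists_forall_eq_zero_of_hasCompactSupport h₀
  obtain ⟨R₁, hR₁, H₁⟩ := exists_forall_eq_zero_of_hasCompactSupport h₁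
  obtain ⟨R₂, hR₂, H₂⟩ := exists_forall_eq_zero_of_hasCompactSupport h₂
  exact ⟨R₀ + R₁ + R₂, by positivity, fun x hx =>
    ⟨H₀ x (by linarith), H₁ x (by linarith), H₂ x (by linarith)⟩⟩

lemma H2Jet.exists_vanishesOutside_ofSmooth {ψ : ℝ → ℝ} (h : ContDiff ℝ ∞ ψ)
    (hc : HasCompactSupport ψ) : ∃ R, 0 < R ∧ SquareForm.VanishesOutside (.ofSmooth ψ h) R :=
  exists_vanishesOutside hc hc.deriv hc.deriv.deriv

end TestFunctions

/-! ### Liouville theorem for bounded weak solutions. -/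

namespace SquareForm

variable (F : SquareForm)

/-- A weak solution can be tested against compactly supported functions of class `H²`. -/
lemma integral_sq_eq_zero_of_weak {f : H2Jet}
    (hw : ∀ (ψ : ℝ → ℝ) (h : ContDiff ℝ ∞ ψ), HasCompactSupport ψ →
      ∫ x, F.sq f (.ofSmooth ψ h) x = 0)
    {h : H2Jet} {R : ℝ} (hh : VanishesOutside h R) : ∫ x in -R..R, F.sq f h x = 0 := by
  set a₁ : ℝ → ℝ := fun x => F.g x * F.P f x + F.r x * F.Z f x with ha₁
  set a₀ : ℝ → ℝ := fun x => F.q x * F.P f x + F.s x * F.Z f x with ha₀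
  have l₁ : LocallyIntegrable a₁ := ((F.loc_P f).continuous_mul F.cont_g).add
    (F.cont_r.mul (F.continuous_Z f)).locallyIntegrable
  have l₀ : LocallyIntegrable a₀ := ((F.loc_P f).continuous_mul F.cont_q).add
    (F.cont_s.mul (F.continuous_Z f)).locallyIntegrable
  have pA₁ := IsPrim.integral l₁
  have pA₀ := IsPrim.integral l₀
  have pA₀₀ := IsPrim.integral pA₀.continuous.locallyIntegrable
  set A₁ : ℝ → ℝ := fun x => ∫ t in (0 : ℝ)..x, a₁ t
  set A₀ : ℝ → ℝ := fun x => ∫ t in (0 : ℝ)..x, a₀ t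
  set A₀₀ : ℝ → ℝ := fun x => ∫ t in (0 : ℝ)..x, A₀ t
  -- Here `sq f k = P f · k'' + a₁ k' + a₀ k`. Integrating by parts once in the `a₁` term and twice
  -- in the `a₀` term puts everything on `k''`, with coefficient `m`.
  set m : ℝ → ℝ := fun x => F.P f x + (A₀₀ x - A₁ x) with hm
  have hmc : Continuous fun x => A₀₀ x - A₁ x := pA₀₀.continuous.sub pA₁.continuous
  have hmloc : LocallyIntegrable m := (F.loc_P f).add hmc.locallyIntegrable
  have hprim : ∀ k : H2Jet, IsPrim
      (fun x => A₁ x * k.f₁ x + (A₀ x * k.f₀ x + (-1) * (A₀₀ x * k.f₁ x)))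
      (fun x => F.sq f k x - m x * k.f₂ x) := fun k => by
    have neg1 : IsPrim (fun _ => (-1 : ℝ)) (fun _ => 0) :=
      .of_hasDerivAt (fun x => hasDerivAt_const x _) continuous_const
    refine ((pA₁.mul k.prim).add ((pA₀.mul k.prim_zero).add
      (neg1.mul (pA₀₀.mul k.prim)))).congr (fun x => rfl) fun x => ?_
    simp only [sq, P, Z, hm, ha₁, ha₀]
    ring
  have hmk : ∀ k : H2Jet, LocallyIntegrable fun x => m x * k.f₂ x := fun k => by
    refine ((F.loc_sq f k).sub (hprim k).loc).congr (Filter.Eventually.of_forall fun x => ?_)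
    simp
  have heq : ∀ (k : H2Jet) (R : ℝ), VanishesOutside k R →
      ∫ x in -R..R, F.sq f k x = ∫ x in -R..R, m x * k.f₂ x := fun k R hk => by
    have h1 := (hprim k).ftc (-R) R
    obtain ⟨p0, p1, -⟩ := hk R (le_abs_self R)
    obtain ⟨n0, n1, -⟩ := hk (-R) (by rw [abs_neg]; exact le_abs_self R)
    rw [intervalIntegral.integral_sub (intervalIntegrable_of_locallyIntegrable (F.loc_sq f k) _ _)
      (intervalIntegrable_of_locallyIntegrable (hmk k) _ _)] at h1
    simp only [p0, p1, n0, n1] at h1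
    linarith
  obtain ⟨α, β, hαβ⟩ := ae_eq_affine_of_integral_mul_deriv_deriv hmloc fun φ hφ hφc => by
    obtain ⟨R, -, hR⟩ := H2Jet.exists_vanishesOutside_ofSmooth hφ hφc
    have h1 := hw φ hφ hφc
    rw [integral_eq_intervalIntegral (R := R) fun x hx => by
      obtain ⟨h0, h1, h2⟩ := hR x hx
      simp [sq, P, Z, h0, h1, h2], heq _ _ hR] at h1
    rw [integral_eq_intervalIntegral (R := R)]
    · exact h1
    · intro x hx
      rw [show deriv (deriv φ) x = 0 from (hR x hx).2.2, mul_zero]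
  rw [heq h R hh, intervalIntegral.integral_congr_ae (g := fun x => (α + β * x) * h.f₂ x)
    (by filter_upwards [hαβ] with x hx _; rw [hx])]
  -- The weak equation has made `m` affine, and an affine function is orthogonal to second
  -- derivatives of compactly supported `H²` functions.
  have paff : IsPrim (fun x => α + β * x) (fun _ => β) :=
    .of_hasDerivAt (fun x => by simpa using ((hasDerivAt_id' x).const_mul β).const_add α)
      continuous_const
  have pneg : IsPrim (fun _ => -β) (fun _ => 0) :=
    .of_hasDerivAt (fun x => hasDerivAt_const x _) continuous_const
  have p := ((paff.mul h.prim).add (pneg.mul h.prim_zero)).ftc (-R) R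
  obtain ⟨p0, p1, -⟩ := hh R (le_abs_self R)
  obtain ⟨n0, n1, -⟩ := hh (-R) (by rw [abs_neg]; exact le_abs_self R)
  simp only [p0, p1, n0, n1] at p
  rw [← sub_eq_zero.2 (rfl : (0 : ℝ) = 0)]
  refine Eq.trans ?_ (p.trans (by ring))
  congr 1
  funext x
  ring

end SquareForm

/-- The product of a function of class `C²` and a function of class `H²_loc`. -/
@[simps] def H2Jet.mul (χ χ₁ χ₂ : ℝ → ℝ) (h₁ : ∀ x, HasDerivAt χ (χ₁ x) x)
    (h₂ : ∀ x, HasDerivAt χ₁ (χ₂ x) x) (hc : Continuous χ₂) (f : H2Jet) : H2Jet where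
  f₀ x := χ x * f.f₀ x
  f₁ x := χ₁ x * f.f₀ x + χ x * f.f₁ x
  f₂ x := χ₂ x * f.f₀ x + 2 * χ₁ x * f.f₁ x + χ x * f.f₂ x
  hasDerivAt x := (h₁ x).mul (f.hasDerivAt x)
  prim := by
    have c₁ : Continuous χ₁ := continuous_iff_continuousAt.2 fun x => (h₂ x).continuousAt
    refine (((IsPrim.of_hasDerivAt h₂ hc).mul f.prim_zero).add
      ((IsPrim.of_hasDerivAt h₁ c₁).mul f.prim)).congr (fun x => rfl) fun x => ?_
    ring
  sq := by
    have c₁ : Continuous χ₁ := continuous_iff_continuousAt.2 fun x => (h₂ x).continuousAt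
    have c₀ : Continuous χ := continuous_iff_continuousAt.2 fun x => (h₁ x).continuousAt
    have d₀ := f.continuous_zero
    have d₁ := f.continuous_one
    have hb : Continuous fun x => χ₂ x * f.f₀ x + 2 * χ₁ x * f.f₁ x := by fun_prop
    have hb2 : Continuous fun x => 2 * (χ₂ x * f.f₀ x + 2 * χ₁ x * f.f₁ x) * χ x := by fun_prop
    refine (((f.sq.continuous_mul (c₀.pow 2)).add (f.prim.loc.continuous_mul hb2)).add
      (hb.pow 2).locallyIntegrable).congr (Filter.Eventually.of_forall fun x => ?_)
    simp only [Pi.add_apply, Pi.pow_apply]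
    ring

/-- The pointwise inequality behind the Liouville theorem, for the values `p`, `z`, `y`, `y₁` of
`P f`, `Z f`, `f`, `f'` and a cutoff `h` with derivatives `h₁`, `h₂` of size at most `δ`. -/
lemma liouville_pointwise {p z y y₁ h h₁ h₂ g q r δ M C : ℝ} (h0 : 0 ≤ h) (h1 : h ≤ 1)
    (hδ : 0 ≤ δ) (hδ1 : δ ≤ 1 / 16) (hh₁ : |h₁| ≤ δ) (hh₂ : |h₂| ≤ δ) (hg : |g| ≤ M)
    (hq : |q| ≤ M) (hr : |r| ≤ M) (hy : |y| ≤ C) :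
    1 / 4 * (h ^ 4 * (p * p + z * z))
        - (2 * (16 + 4 * M) ^ 2 + 8 * M ^ 2 + 128 * (5 + M ^ 2 + M)) * C ^ 2 * δ ^ 2 ≤
      (h ^ 4 * (p * p + z * z) + 8 * h ^ 3 * h₁ * y₁ * p
        + h ^ 2 * (12 * h₁ ^ 2 + 4 * h * h₂ + 4 * g * h * h₁) * y * p + 4 * r * h ^ 3 * h₁ * y * z)
      + 128 * δ ^ 2 * (2 * h * h₁ * y * y₁ + h ^ 2 * y₁ ^ 2
        + h ^ 2 * y * (p - g * y₁ - q * y)) := by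
  have hM : 0 ≤ M := (abs_nonneg g).trans hg
  have hh₁s : h₁ ^ 2 ≤ δ ^ 2 := sq_le_sq' (abs_le.1 hh₁).1 (abs_le.1 hh₁).2
  have hys : y ^ 2 ≤ C ^ 2 := sq_le_sq' (abs_le.1 hy).1 (abs_le.1 hy).2
  have hgs : g ^ 2 ≤ M ^ 2 := sq_le_sq' (abs_le.1 hg).1 (abs_le.1 hg).2
  have hrs : r ^ 2 ≤ M ^ 2 := sq_le_sq' (abs_le.1 hr).1 (abs_le.1 hr).2
  have hhs : h ^ 2 ≤ 1 := pow_le_one₀ h0 h1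
  have hδs : δ ^ 2 ≤ 1 / 256 := by nlinarith
  -- `h² w` is the coefficient of `y` in `P (h⁴ f)` beyond `h⁴ P f`. The fourth power of the cutoff
  -- leaves a factor `h²` after two derivatives, so each error containing `p` or `z` can be absorbed
  -- into `h⁴ p²` or `h⁴ z²`.
  set w := 12 * h₁ ^ 2 + 4 * h * h₂ + 4 * g * h * h₁ with hw
  have hwb : |w| ≤ (16 + 4 * M) * δ := by
    have e1 : |12 * h₁ ^ 2| ≤ 12 * δ := by
      rw [abs_of_nonneg (by positivity)]; nlinarith
    have e2 : |4 * h * h₂| ≤ 4 * δ := by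
      rw [abs_mul, abs_of_nonneg (by positivity : 0 ≤ 4 * h)]
      nlinarith [abs_nonneg h₂]
    have e3 : |4 * g * h * h₁| ≤ 4 * M * δ := by
      rw [abs_mul, abs_mul, abs_mul, abs_of_nonneg h0, abs_of_pos (by norm_num : (0 : ℝ) < 4)]
      have : |g| * h ≤ M * 1 := mul_le_mul hg h1 h0 hM
      have : |g| * h * |h₁| ≤ M * 1 * δ := mul_le_mul this hh₁ (abs_nonneg _) (by linarith)
      linarith
    have := abs_add_le (12 * h₁ ^ 2 + 4 * h * h₂) (4 * g * h * h₁)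
    have := abs_add_le (12 * h₁ ^ 2) (4 * h * h₂)
    rw [hw]
    linarith
  clear_value w
  have hws : w ^ 2 ≤ (16 + 4 * M) ^ 2 * δ ^ 2 := by
    rw [← mul_pow]; exact sq_le_sq' (abs_le.1 hwb).1 (abs_le.1 hwb).2
  -- The only error containing `y₁` costs `64 δ² h² y₁²`. It is repaid by `128 δ²` times the
  -- derivative of `h² f f'`, which by `b8` supplies half of `h² y₁²`; this fixes the factor `128`.
  have b1 : -(1 / 4 * (h ^ 4 * p ^ 2) + 64 * δ ^ 2 * (h ^ 2 * y₁ ^ 2)) ≤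
      8 * h ^ 3 * h₁ * y₁ * p := by
    have e : h₁ ^ 2 * (h ^ 2 * y₁ ^ 2) ≤ δ ^ 2 * (h ^ 2 * y₁ ^ 2) :=
      mul_le_mul_of_nonneg_right hh₁s (by positivity)
    linarith [sq_nonneg (1 / 2 * (h ^ 2 * p) + 8 * (h * h₁ * y₁))]
  have b2 : -(1 / 8 * (h ^ 4 * p ^ 2) + 2 * ((16 + 4 * M) ^ 2 * δ ^ 2 * C ^ 2)) ≤
      h ^ 2 * w * y * p := by
    have e : w ^ 2 * y ^ 2 ≤ (16 + 4 * M) ^ 2 * δ ^ 2 * C ^ 2 :=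
      mul_le_mul hws hys (sq_nonneg _) (by positivity)
    linarith [sq_nonneg (h ^ 2 * p + 4 * (w * y))]
  have b3 : -(1 / 2 * (h ^ 4 * z ^ 2) + 8 * (M ^ 2 * δ ^ 2 * C ^ 2)) ≤
      4 * r * h ^ 3 * h₁ * y * z := by
    have e1 : r ^ 2 * h₁ ^ 2 ≤ M ^ 2 * δ ^ 2 := mul_le_mul hrs hh₁s (sq_nonneg _) (by positivity)
    have e2 : r ^ 2 * h₁ ^ 2 * y ^ 2 ≤ M ^ 2 * δ ^ 2 * C ^ 2 :=
      mul_le_mul e1 hys (sq_nonneg _) (by positivity)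
    have e3 : r ^ 2 * h₁ ^ 2 * y ^ 2 * h ^ 2 ≤ r ^ 2 * h₁ ^ 2 * y ^ 2 :=
      mul_le_of_le_one_right (by positivity) hhs
    linarith [sq_nonneg (h ^ 2 * z + 4 * (r * h * h₁ * y))]
  have b4 : -(1 / 4 * (h ^ 2 * y₁ ^ 2) + 4 * C ^ 2) ≤ 2 * h * h₁ * y * y₁ := by
    have e : h₁ ^ 2 * y ^ 2 ≤ 1 * C ^ 2 := mul_le_mul (by linarith) hys (sq_nonneg _) (by norm_num)
    linarith [sq_nonneg (1 / 2 * (h * y₁) + 2 * (h₁ * y))]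
  have b5 : -(1 / 2 * (h ^ 4 * p ^ 2) + 1 / 2 * C ^ 2) ≤ h ^ 2 * y * p := by
    linarith [sq_nonneg (h ^ 2 * p + y)]
  have b6 : -(1 / 4 * (h ^ 2 * y₁ ^ 2) + M ^ 2 * C ^ 2) ≤ -(h ^ 2 * y * g * y₁) := by
    have e1 : g ^ 2 * y ^ 2 ≤ M ^ 2 * C ^ 2 := mul_le_mul hgs hys (sq_nonneg _) (by positivity)
    have e2 : g ^ 2 * y ^ 2 * h ^ 2 ≤ g ^ 2 * y ^ 2 := mul_le_of_le_one_right (by positivity) hhs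
    linarith [sq_nonneg (1 / 2 * (h * y₁) - g * y * h)]
  have b7 : -(M * C ^ 2) ≤ -(h ^ 2 * y * q * y) := by
    have e1 : q * y ^ 2 ≤ M * C ^ 2 :=
      (mul_le_mul_of_nonneg_right ((le_abs_self q).trans hq) (sq_nonneg y)).trans
        (mul_le_mul_of_nonneg_left hys hM)
    have e2 : h ^ 2 * (q * y ^ 2) ≤ M * C ^ 2 := by
      have e3 : h ^ 2 * (q * y ^ 2) ≤ h ^ 2 * (M * C ^ 2) :=
        mul_le_mul_of_nonneg_left e1 (sq_nonneg h)
      have e4 : h ^ 2 * (M * C ^ 2) ≤ M * C ^ 2 := mul_le_of_le_one_left (by positivity) hhs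
      linarith
    linarith
  have b8 : -(1 / 2 * (h ^ 4 * p ^ 2)) - (5 + M ^ 2 + M) * C ^ 2 + 1 / 2 * (h ^ 2 * y₁ ^ 2) ≤
      2 * h * h₁ * y * y₁ + h ^ 2 * y₁ ^ 2 + h ^ 2 * y * (p - g * y₁ - q * y) := by
    linarith [sq_nonneg C]
  have b9 := mul_le_mul_of_nonneg_left b8 (by positivity : 0 ≤ 128 * δ ^ 2)
  -- The bound `δ ≤ 1/16` limits the cost of the repayment to a quarter of `h⁴ p²`, so that of `h⁴
  -- p²` the fraction `1 - 1/4 - 1/8 - 1/4 ≥ 1/4` survives.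
  have b10 : δ ^ 2 * (h ^ 4 * p ^ 2) ≤ 1 / 256 * (h ^ 4 * p ^ 2) :=
    mul_le_mul_of_nonneg_right hδs (by positivity)
  have b11 : 0 ≤ h ^ 4 * p ^ 2 := by positivity
  have b12 : 0 ≤ h ^ 4 * z ^ 2 := by positivity
  linarith

/-- Smooth cutoffs at scale `R`. -/
lemma exists_cutoff : ∃ c : ℝ, 0 < c ∧ ∀ R : ℝ, 1 ≤ R → ∃ η η₁ η₂ : ℝ → ℝ,
    (∀ x, HasDerivAt η (η₁ x) x) ∧ (∀ x, HasDerivAt η₁ (η₂ x) x) ∧ Continuous η₂ ∧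
    (∀ x, 0 ≤ η x) ∧ (∀ x, η x ≤ 1) ∧ (∀ x, |x| ≤ R → η x = 1) ∧
    (∀ x, 2 * R ≤ |x| → η x = 0) ∧ (∀ x, |η₁ x| ≤ c / R) ∧ (∀ x, |η₂ x| ≤ c / R) := by
  let b : ContDiffBump (0 : ℝ) := ⟨1, 2, by norm_num, by norm_num⟩
  have hb : ContDiff ℝ ∞ (b : ℝ → ℝ) := b.contDiff
  have hb1 := contDiff_infty_iff_deriv.1 hb
  have hb2 := contDiff_infty_iff_deriv.1 hb1.2
  have hc : HasCompactSupport (b : ℝ → ℝ) := b.hasCompactSupport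
  obtain ⟨c₁, hc₁⟩ := hb2.1.continuous.bounded_above_of_compact_support hc.deriv
  obtain ⟨c₂, hc₂⟩ := hb2.2.continuous.bounded_above_of_compact_support hc.deriv.deriv
  have hc₁0 : 0 ≤ c₁ := (norm_nonneg _).trans (hc₁ 0)
  have hc₂0 : 0 ≤ c₂ := (norm_nonneg _).trans (hc₂ 0)
  refine ⟨c₁ + c₂ + 1, by positivity, fun R hR => ?_⟩
  have hR0 : 0 < R := by linarith
  have hs : ∀ x : ℝ, HasDerivAt (fun x => x / R) (1 / R) x := fun x =>
    (hasDerivAt_id' x).div_const R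
  refine ⟨fun x => b (x / R), fun x => deriv b (x / R) * (1 / R),
    fun x => deriv (deriv b) (x / R) * (1 / R) * (1 / R), fun x => ?_, fun x => ?_, ?_,
    fun x => b.nonneg, fun x => b.le_one, fun x hx => ?_, fun x hx => ?_, fun x => ?_, fun x => ?_⟩
  · exact HasDerivAt.comp (h₂ := (b : ℝ → ℝ)) (h := fun x => x / R) x
      (hb1.1 (x / R)).hasDerivAt (hs x)
  · exact ((hb2.1 (x / R)).hasDerivAt.comp x (hs x)).mul_const _
  · have := hb2.2.continuous
    fun_prop
  · refine b.one_of_mem_closedBall ?_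
    rw [Metric.mem_closedBall, dist_zero_right, Real.norm_eq_abs, abs_div, abs_of_pos hR0]
    exact (div_le_one hR0).2 hx
  · refine b.zero_of_le_dist ?_
    rw [dist_zero_right, Real.norm_eq_abs, abs_div, abs_of_pos hR0]
    exact (le_div_iff₀ hR0).2 hx
  · have := hc₁ (x / R)
    rw [Real.norm_eq_abs] at this
    rw [abs_mul, abs_of_pos (by positivity : 0 < 1 / R), mul_one_div]
    gcongr
    linarith
  · have := hc₂ (x / R)
    rw [Real.norm_eq_abs] at this
    rw [abs_mul, abs_mul, abs_of_pos (by positivity : 0 < 1 / R), mul_one_div, mul_one_div]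
    have h1 : |deriv (deriv b) (x / R)| / R ≤ |deriv (deriv b) (x / R)| :=
      div_le_self (abs_nonneg _) hR
    gcongr
    linarith

namespace SquareForm

variable (F : SquareForm)

/-- The pointwise inequality is integrated. On its larger side stand the weak equation tested
against `η⁴ f` and a multiple of `(η² f f')'`, both of integral zero. -/
lemma integral_cutoff_sq_le {f : H2Jet} {C M δ L : ℝ} {η η₁ η₂ : ℝ → ℝ}
    (hf : ∀ x, |f.f₀ x| ≤ C) (hg : ∀ x, |F.g x| ≤ M) (hq : ∀ x, |F.q x| ≤ M)
    (hr : ∀ x, |F.r x| ≤ M)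
    (hw : ∀ (ψ : ℝ → ℝ) (h : ContDiff ℝ ∞ ψ), HasCompactSupport ψ →
      ∫ x, F.sq f (.ofSmooth ψ h) x = 0)
    (d₁ : ∀ x, HasDerivAt η (η₁ x) x) (d₂ : ∀ x, HasDerivAt η₁ (η₂ x) x) (hc : Continuous η₂)
    (h0 : ∀ x, 0 ≤ η x) (h1 : ∀ x, η x ≤ 1) (hL : 0 ≤ L) (hv : ∀ x, L ≤ |x| → η x = 0)
    (hδ : 0 ≤ δ) (hδ1 : δ ≤ 1 / 16) (b₁ : ∀ x, |η₁ x| ≤ δ) (b₂ : ∀ x, |η₂ x| ≤ δ) :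
    ∫ x in -L..L, η x ^ 4 * F.sq f f x ≤
      4 * ((2 * (16 + 4 * M) ^ 2 + 8 * M ^ 2 + 128 * (5 + M ^ 2 + M)) * C ^ 2 * δ ^ 2)
        * (2 * L) := by
  set K := (2 * (16 + 4 * M) ^ 2 + 8 * M ^ 2 + 128 * (5 + M ^ 2 + M)) * C ^ 2 * δ ^ 2 with hK
  clear_value K
  have c₁ : Continuous η₁ := continuous_iff_continuousAt.2 fun x => (d₂ x).continuousAt
  have c₀ : Continuous η := continuous_iff_continuousAt.2 fun x => (d₁ x).continuousAt
  have hχ₁ : ∀ x, HasDerivAt (fun x => η x ^ 4) (4 * η x ^ 3 * η₁ x) x := fun x => by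
    simpa using (d₁ x).fun_pow 4
  have hχ₂ : ∀ x, HasDerivAt (fun x => 4 * η x ^ 3 * η₁ x)
      (12 * η x ^ 2 * η₁ x ^ 2 + 4 * η x ^ 3 * η₂ x) x := fun x => by
    refine ((((d₁ x).fun_pow 3).const_mul 4).fun_mul (d₂ x)).congr_deriv ?_
    push_cast
    ring
  have hχc : Continuous fun x => 12 * η x ^ 2 * η₁ x ^ 2 + 4 * η x ^ 3 * η₂ x := by fun_prop
  set h : H2Jet := f.mul _ _ _ hχ₁ hχ₂ hχc with hh
  have hvan : VanishesOutside h L := fun x hx => by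
    have := hv x hx
    simp [hh, this]
  have I₁ : ∫ x in -L..L, F.sq f h x = 0 := F.integral_sq_eq_zero_of_weak hw hvan
  have pη : IsPrim η η₁ := .of_hasDerivAt d₁ c₁
  have p₂ := (pη.mul pη).mul (f.prim_zero.mul f.prim)
  have I₂ := p₂.ftc (-L) L
  rw [hv L (le_abs_self L), hv (-L) (by rw [abs_neg]; exact le_abs_self L)] at I₂
  simp only [mul_zero, zero_mul, sub_zero] at I₂
  have i₁ := intervalIntegrable_of_locallyIntegrable (F.loc_sq f h) (-L) L
  have i₂ := intervalIntegrable_of_locallyIntegrable p₂.loc (-L) L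
  have i₃ := intervalIntegrable_of_locallyIntegrable
    ((F.loc_sq f f).continuous_mul (c₀.pow 4)) (-L) L
  have hmono := intervalIntegral.integral_mono_on (a := -L) (b := L) (by linarith)
    ((i₃.const_mul (1 / 4)).sub (intervalIntegrable_const (c := K)))
    (i₁.add (i₂.const_mul (128 * δ ^ 2))) fun x _ => by
      have := liouville_pointwise (p := F.P f x) (z := F.Z f x) (y := f.f₀ x) (y₁ := f.f₁ x)
        (h0 x) (h1 x) hδ hδ1 (b₁ x) (b₂ x) (hg x) (hq x) (hr x) (hf x)
      rw [← hK] at this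
      have e₁ : F.sq f h x = η x ^ 4 * (F.P f x * F.P f x + F.Z f x * F.Z f x)
          + 8 * η x ^ 3 * η₁ x * f.f₁ x * F.P f x
          + η x ^ 2 * (12 * η₁ x ^ 2 + 4 * η x * η₂ x + 4 * F.g x * η x * η₁ x) * f.f₀ x * F.P f x
          + 4 * F.r x * η x ^ 3 * η₁ x * f.f₀ x * F.Z f x := by
        simp only [sq, hh, P, Z, H2Jet.mul_f₀, H2Jet.mul_f₁, H2Jet.mul_f₂]
        ring
      have e₂ : F.sq f f x = F.P f x * F.P f x + F.Z f x * F.Z f x := rfl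
      have e₃ : f.f₂ x = F.P f x - F.g x * f.f₁ x - F.q x * f.f₀ x := by
        simp only [P]; ring
      simp only [Pi.pow_apply, e₁, e₂]
      rw [e₃]
      refine this.trans (le_of_eq ?_)
      ring
  rw [intervalIntegral.integral_sub (i₃.const_mul _) intervalIntegrable_const,
    intervalIntegral.integral_add i₁ (i₂.const_mul _), intervalIntegral.integral_const_mul,
    intervalIntegral.integral_const_mul, I₁, I₂, intervalIntegral.integral_const] at hmono
  simp only [Pi.pow_apply, smul_eq_mul] at hmono
  linarith

/-- A bounded weak solution is annihilated by both operators. -/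
theorem ae_sq_eq_zero_of_bounded_weak {f : H2Jet} (hf : ∃ C, ∀ x, |f.f₀ x| ≤ C)
    (hw : ∀ (ψ : ℝ → ℝ) (h : ContDiff ℝ ∞ ψ), HasCompactSupport ψ →
      ∫ x, F.sq f (.ofSmooth ψ h) x = 0) :
    ∀ᵐ x, F.sq f f x = 0 := by
  obtain ⟨C, hC⟩ := hf
  obtain ⟨Mg, hMg⟩ := exists_bound_of_periodic F.T_pos F.per_g F.cont_g
  obtain ⟨Mq, hMq⟩ := exists_bound_of_periodic F.T_pos F.per_q F.cont_q
  obtain ⟨Mr, hMr⟩ := exists_bound_of_periodic F.T_pos F.per_r F.cont_r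
  obtain ⟨c, hc0, hcut⟩ := exists_cutoff
  have := (abs_nonneg _).trans (hMg 0)
  have := (abs_nonneg _).trans (hMq 0)
  have := (abs_nonneg _).trans (hMr 0)
  set M := Mg + Mq + Mr with hM
  set K := (2 * (16 + 4 * M) ^ 2 + 8 * M ^ 2 + 128 * (5 + M ^ 2 + M)) * C ^ 2 with hK
  have hM0 : 0 ≤ M := by positivity
  have hK0 : 0 ≤ K := by positivity
  -- Here `δ = c / R` and the cutoff lives on an interval of length `4 R`, so the bound is `4 K (c /
  -- R)² · 4 R`.
  have key : ∀ R, 1 ≤ R → 16 * c ≤ R → ∫ x in -R..R, F.sq f f x ≤ 16 * K * c ^ 2 / R := by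
    intro R hR hRc
    have hR0 : 0 < R := by linarith
    obtain ⟨η, η₁, η₂, d₁, d₂, hηc, h0, h1, hone, hzero, b₁, b₂⟩ := hcut R hR
    have hmain := F.integral_cutoff_sq_le (M := M) hC (fun x => (hMg x).trans (by linarith))
      (fun x => (hMq x).trans (by linarith)) (fun x => (hMr x).trans (by linarith)) hw d₁ d₂ hηc
      h0 h1 (by linarith) hzero (by positivity) (by rw [div_le_iff₀ hR0]; linarith) b₁ b₂
    rw [← hK] at hmain
    have c₀ : Continuous η := continuous_iff_continuousAt.2 fun x => (d₁ x).continuousAt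
    have hle : ∫ x in -R..R, F.sq f f x ≤ ∫ x in -(2 * R)..(2 * R), η x ^ 4 * F.sq f f x := by
      have e : ∫ x in -R..R, F.sq f f x = ∫ x in -R..R, η x ^ 4 * F.sq f f x := by
        refine intervalIntegral.integral_congr fun x hx => ?_
        rw [uIcc_of_le (by linarith)] at hx
        simp [hone x (abs_le.2 hx)]
      rw [e]
      refine intervalIntegral.integral_mono_interval (by linarith) (by linarith) (by linarith)
        (Filter.Eventually.of_forall fun x =>
          mul_nonneg (pow_nonneg (h0 x) 4) (F.sq_self_nonneg f x))
        (intervalIntegrable_of_locallyIntegrable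
          ((F.loc_sq f f).continuous_mul (c₀.pow 4)) _ _)
    refine hle.trans (hmain.trans (le_of_eq ?_))
    field_simp
    ring
  refine ae_eq_zero_of_integral_le_zero (F.loc_sq f f) (F.sq_self_nonneg f) fun r =>
    ⟨max r 1, le_max_left _ _, le_of_forall_pos_le_add fun ε hε => ?_⟩
  set R := max (max r 1) (max (16 * c) (16 * K * c ^ 2 / ε)) with hR
  have hR1 : 1 ≤ R := (le_max_right _ _).trans (le_max_left _ _)
  have hRr : max r 1 ≤ R := le_max_left _ _
  have hRc : 16 * c ≤ R := (le_max_left _ _).trans (le_max_right _ _)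
  have hRε : 16 * K * c ^ 2 / ε ≤ R := (le_max_right _ _).trans (le_max_right _ _)
  have h1 := key R hR1 hRc
  have hR0 : 0 < R := by linarith
  have h2 : 16 * K * c ^ 2 / R ≤ ε := by
    rw [div_le_iff₀ hε] at hRε
    rw [div_le_iff₀ hR0]
    linarith
  have hm : 1 ≤ max r 1 := le_max_right _ _
  have h3 : ∫ x in -(max r 1)..(max r 1), F.sq f f x ≤ ∫ x in -R..R, F.sq f f x :=
    intervalIntegral.integral_mono_interval (by linarith) (by linarith) hRr
      (Filter.Eventually.of_forall fun x => F.sq_self_nonneg f x)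
      (intervalIntegrable_of_locallyIntegrable (F.loc_sq f f) _ _)
  linarith

end SquareForm

/-! ### Uniqueness for `P f = 0`, and vanishing of the squares in the periodic case. -/

namespace SquareForm

variable (F : SquareForm)

/-- The equation identifies `f₂` almost everywhere with a continuous function, so `f₁` is its
classical primitive and uniqueness for ordinary differential equations becomes available. -/
lemma hasDerivAt_of_ae_P_eq_zero {f : H2Jet} (h : ∀ᵐ x, F.P f x = 0) (x : ℝ) :
    HasDerivAt f.f₁ (-(F.g x * f.f₁ x) - F.q x * f.f₀ x) x := by
  have hc : Continuous fun x => -(F.g x * f.f₁ x) - F.q x * f.f₀ x :=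
    (F.cont_g.mul f.continuous_one).neg.sub (F.cont_q.mul f.continuous_zero)
  have hae : ∀ᵐ x, f.f₂ x = -(F.g x * f.f₁ x) - F.q x * f.f₀ x := by
    filter_upwards [h] with x hx
    unfold P at hx
    linarith
  have e : f.f₁ = fun x => (∫ t in (0 : ℝ)..x, (-(F.g t * f.f₁ t) - F.q t * f.f₀ t)) + f.f₁ 0 := by
    funext x
    rw [← intervalIntegral.integral_congr_ae (f := f.f₂)
      (by filter_upwards [hae] with t ht _; exact ht), f.prim.ftc]
    ring
  have hd := (intervalIntegral.integral_hasDerivAt_right (hc.intervalIntegrable 0 x)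
    (hc.stronglyMeasurableAtFilter _ _) hc.continuousAt).add_const (f.f₁ 0)
  rwa [← e] at hd

/-- Solutions of `P f = 0` are determined by their Cauchy data at the origin. -/
lemma eq_of_ae_P_eq_zero {f k : H2Jet} (hf : ∀ᵐ x, F.P f x = 0) (hk : ∀ᵐ x, F.P k x = 0)
    (h0 : f.f₀ 0 = k.f₀ 0) (h1 : f.f₁ 0 = k.f₁ 0) : f.f₀ = k.f₀ := by
  obtain ⟨Mg, hMg⟩ := exists_bound_of_periodic F.T_pos F.per_g F.cont_g
  obtain ⟨Mq, hMq⟩ := exists_bound_of_periodic F.T_pos F.per_q F.cont_q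
  have hg0 := (abs_nonneg _).trans (hMg 0)
  have hq0 := (abs_nonneg _).trans (hMq 0)
  let v : ℝ → ℝ × ℝ → ℝ × ℝ := fun t p => (p.2, -(F.g t * p.2) - F.q t * p.1)
  have hsol : ∀ j : H2Jet, (∀ᵐ x, F.P j x = 0) → ∀ t,
      HasDerivAt (fun x => (j.f₀ x, j.f₁ x)) (v t (j.f₀ t, j.f₁ t)) t ∧
        (j.f₀ t, j.f₁ t) ∈ (univ : Set (ℝ × ℝ)) := fun j hj t =>
    ⟨(j.hasDerivAt t).prodMk (F.hasDerivAt_of_ae_P_eq_zero hj t), mem_univ _⟩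
  have hLip : ∀ t, LipschitzOnWith (Real.toNNReal (1 + Mg + Mq)) (v t) univ := by
    intro t
    refine (LipschitzWith.of_dist_le_mul fun p p' => ?_).lipschitzOnWith
    rw [Real.coe_toNNReal _ (by positivity)]
    simp only [Prod.dist_eq, Real.dist_eq, v]
    have m1 := le_max_left |p.1 - p'.1| |p.2 - p'.2|
    have m2 := le_max_right |p.1 - p'.1| |p.2 - p'.2|
    set m := max |p.1 - p'.1| |p.2 - p'.2|
    have m0 : 0 ≤ m := (abs_nonneg _).trans m1
    have k1 : |F.g t| * |p.2 - p'.2| ≤ Mg * m := mul_le_mul (hMg t) m2 (abs_nonneg _) hg0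
    have k2 : |F.q t| * |p.1 - p'.1| ≤ Mq * m := mul_le_mul (hMq t) m1 (abs_nonneg _) hq0
    refine max_le ?_ ?_
    · have := mul_nonneg hg0 m0
      have := mul_nonneg hq0 m0
      linarith
    · rw [show -(F.g t * p.2) - F.q t * p.1 - (-(F.g t * p'.2) - F.q t * p'.1)
        = -(F.g t * (p.2 - p'.2)) - F.q t * (p.1 - p'.1) by ring]
      have := abs_sub (-(F.g t * (p.2 - p'.2))) (F.q t * (p.1 - p'.1))
      rw [abs_neg, abs_mul, abs_mul] at this
      linarith
  have := ODE_solution_unique_univ (t₀ := 0) hLip (hsol f hf) (hsol k hk) (by rw [h0, h1])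
  funext x
  exact congrArg Prod.fst (congrFun this x)

/-- If the integral of `sq f f` over a period vanishes then so does `sq f f`. -/
lemma ae_sq_eq_zero_of_periodic {f : H2Jet} {N : ℕ} (hN : 1 ≤ N)
    (h0 : Function.Periodic f.f₀ (N * F.T)) (h1 : Function.Periodic f.f₁ (N * F.T))
    (h2 : Function.Periodic f.f₂ (N * F.T)) (hintegral : ∫ x in 0..(N * F.T), F.sq f f x = 0) :
    ∀ᵐ x, F.sq f f x = 0 := by
  have hper : Function.Periodic (F.sq f f) (N * F.T) := fun x => by
    simp only [sq, P, Z, h0 x, h1 x, h2 x, F.per_g.nat_mul N x, F.per_q.nat_mul N x,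
      F.per_r.nat_mul N x, F.per_s.nat_mul N x]
  have hT : 0 < N * F.T := mul_pos (by exact_mod_cast hN) F.T_pos
  refine ae_eq_zero_of_integral_le_zero (F.loc_sq f f) (F.sq_self_nonneg f) fun r => ?_
  obtain ⟨n, hn⟩ := exists_nat_gt (r / (N * F.T))
  rw [div_lt_iff₀ hT] at hn
  -- The symmetric interval consists of `2 n` full periods, each contributing zero.
  refine ⟨n * (N * F.T), hn.le, le_of_eq ?_⟩
  have e := hper.intervalIntegral_add_zsmul_eq (2 * n : ℤ) (-(n * (N * F.T)))
    (fun a b => intervalIntegrable_of_locallyIntegrable (F.loc_sq f f) a b)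
  have e2 : -(n * (N * F.T)) + (2 * n : ℤ) • (N * F.T) = n * (N * F.T) := by
    rw [zsmul_eq_mul]; push_cast; ring
  rw [e2] at e
  have e3 := hper.intervalIntegral_add_eq (-(n * (N * F.T))) 0
  rw [zero_add] at e3
  rw [e, e3, hintegral, smul_zero]

end SquareForm

/-! ### The two sums of squares attached to the wave, and their kernels. -/

namespace IsCnoidal

variable {e T : ℝ} {U V : ℝ → ℝ}

lemma continuous_U (H : IsCnoidal e T U V) : Continuous U :=
  continuous_iff_continuousAt.2 fun x => (H.hasDerivAt x).continuousAt

lemma continuous_V (H : IsCnoidal e T U V) : Continuous V :=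
  continuous_iff_continuousAt.2 fun x => (H.hasDerivAt' x).continuousAt

lemma one_sub_sq_ne_zero (H : IsCnoidal e T U V) (x : ℝ) : 1 - U x ^ 2 ≠ 0 :=
  (H.pos.trans_le (H.le x)).ne'

lemma V_zero_ne_zero (H : IsCnoidal e T U V) : V 0 ≠ 0 := by
  intro h0
  have := H.first_integral 0
  rw [h0, H.zero] at this
  nlinarith [H.pos, H.lt_one]

lemma continuous_ratio (H : IsCnoidal e T U V) : Continuous fun x => V x / (1 - U x ^ 2) :=
  H.continuous_V.div (continuous_const.sub (H.continuous_U.pow 2)) H.one_sub_sq_ne_zero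

/-- The term `-U` has no denominator because `V' = -U (1 - U²)`. -/
lemma hasDerivAt_ratio (H : IsCnoidal e T U V) (x : ℝ) : HasDerivAt (fun x => V x / (1 - U x ^ 2))
    (-U x + 2 * U x * (V x / (1 - U x ^ 2)) ^ 2) x := by
  have hn := H.one_sub_sq_ne_zero x
  refine ((H.hasDerivAt' x).div (((H.hasDerivAt x).fun_pow 2).const_sub 1) hn).congr_deriv ?_
  field_simp
  push_cast
  ring

lemma hasDerivAt_mul (H : IsCnoidal e T U V) (x : ℝ) :
    HasDerivAt (fun x => U x * V x) (V x ^ 2 + U x * (U x ^ 3 - U x)) x := by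
  refine ((H.hasDerivAt x).fun_mul (H.hasDerivAt' x)).congr_deriv ?_
  ring

/-- The form acting on the real part of the perturbation. -/
noncomputable def plusForm (H : IsCnoidal e T U V) : SquareForm where
  T := T
  -- With `ρ = V / (1 - U²)`, the choices `g = U ρ` and `r = ρ` give `g² + r² - g' = U²`: the
  -- quotients disappear from the coefficient of `f' h'`.
  g x := U x * (V x / (1 - U x ^ 2))
  q x := 1 - 2 * U x ^ 2
  r x := V x / (1 - U x ^ 2)
  s := U
  γ x := 4 * (U x * V x)
  g' x := V x * (V x / (1 - U x ^ 2)) + U x * (-U x + 2 * U x * (V x / (1 - U x ^ 2)) ^ 2)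
  q' x := -(4 * (U x * V x))
  γ' x := 4 * (V x ^ 2 + U x * (U x ^ 3 - U x))
  T_pos := H.period_pos
  hg x := (H.hasDerivAt x).fun_mul (H.hasDerivAt_ratio x)
  hq x := ((((H.hasDerivAt x).fun_pow 2).const_mul 2).const_sub 1).congr_deriv (by push_cast; ring)
  hγ x := (H.hasDerivAt_mul x).const_mul 4
  cont_g' := by
    have := H.continuous_U; have := H.continuous_V; have := H.continuous_ratio; fun_prop
  cont_q' := by
    have := H.continuous_U; have := H.continuous_V; fun_prop
  cont_γ' := by
    have := H.continuous_U; have := H.continuous_V; fun_prop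
  cont_r := H.continuous_ratio
  cont_s := H.continuous_U
  per_g x := by simp only [H.periodic x, H.periodic' x]
  per_q x := by simp only [H.periodic x]
  per_r x := by simp only [H.periodic x, H.periodic' x]
  per_s := H.periodic
  per_γ x := by simp only [H.periodic x, H.periodic' x]

/-- The form acting on the imaginary part of the perturbation. -/
noncomputable def minusForm (H : IsCnoidal e T U V) : SquareForm where
  T := T
  -- `P` is the operator of the profile equation and `Z` is the Wronskian with `U`.
  g _ := 0
  q x := 1 - U x ^ 2
  r := U
  s x := -V x
  γ x := U x * V x
  g' _ := 0
  q' x := -(2 * (U x * V x))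
  γ' x := V x ^ 2 + U x * (U x ^ 3 - U x)
  T_pos := H.period_pos
  hg x := hasDerivAt_const x 0
  hq x := (((H.hasDerivAt x).fun_pow 2).const_sub 1).congr_deriv (by push_cast; ring)
  hγ := H.hasDerivAt_mul
  cont_g' := continuous_const
  cont_q' := by
    have := H.continuous_U; have := H.continuous_V; fun_prop
  cont_γ' := by
    have := H.continuous_U; have := H.continuous_V; fun_prop
  cont_r := H.continuous_U
  cont_s := H.continuous_V.neg
  per_g _ := rfl
  per_q x := by simp only [H.periodic x]
  per_r := H.periodic
  per_s x := by simp only [H.periodic' x]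
  per_γ x := by simp only [H.periodic x, H.periodic' x]

/-- The right-hand side is half the second variation density in real directions. The relation `V = ρ
(1 - U²)` clears the quotients, and the first integral matches the zeroth-order coefficient,
including `(3 - e²) / 2`. -/
lemma plusForm_form (H : IsCnoidal e T U V) (f h : H2Jet) (x : ℝ) : H.plusForm.form f h x =
    f.f₂ x * h.f₂ x + (5 * U x ^ 2 - 2) * (f.f₁ x * h.f₁ x)
      + 10 * U x * V x * (f.f₀ x * h.f₁ x + f.f₁ x * h.f₀ x)
      + (5 * V x ^ 2 + 15 / 2 * U x ^ 4 - (3 - e ^ 2) / 2 - 2 * (3 * U x ^ 2 - 1))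
        * (f.f₀ x * h.f₀ x) := by
  have hn := H.one_sub_sq_ne_zero x
  have hV : V x = V x / (1 - U x ^ 2) * (1 - U x ^ 2) := by field_simp
  have hI := H.first_integral x
  simp only [SquareForm.form, plusForm]
  set ρ := V x / (1 - U x ^ 2)
  linear_combination (-ρ * (f.f₁ x * h.f₁ x)
    - 2 * U x * (f.f₀ x * h.f₁ x + f.f₁ x * h.f₀ x)) * hV - (f.f₀ x * h.f₀ x) * hI

lemma minusForm_form (H : IsCnoidal e T U V) (f h : H2Jet) (x : ℝ) : H.minusForm.form f h x =
    f.f₂ x * h.f₂ x + (3 * U x ^ 2 - 2) * (f.f₁ x * h.f₁ x)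
      + 2 * U x * V x * (f.f₀ x * h.f₁ x + f.f₁ x * h.f₀ x)
      + (3 * V x ^ 2 + 3 / 2 * U x ^ 4 - (3 - e ^ 2) / 2 - 2 * (U x ^ 2 - 1))
        * (f.f₀ x * h.f₀ x) := by
  have hI := H.first_integral x
  simp only [SquareForm.form, minusForm]
  linear_combination (-(f.f₀ x * h.f₀ x)) * hI

/-- The jet of `a U'`. -/
noncomputable def derivJet (H : IsCnoidal e T U V) (a : ℝ) : H2Jet :=
  .ofContinuous (fun x => a * V x) (fun x => a * (U x ^ 3 - U x))
    (fun x => a * ((3 * U x ^ 2 - 1) * V x)) (fun x => (H.hasDerivAt' x).const_mul a)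
    (fun x => ((((H.hasDerivAt x).fun_pow 3).fun_sub (H.hasDerivAt x)).const_mul a).congr_deriv
      (by push_cast; ring))
    (by have := H.continuous_U; have := H.continuous_V; fun_prop)

/-- The jet of `b U`. -/
noncomputable def selfJet (H : IsCnoidal e T U V) (b : ℝ) : H2Jet :=
  .ofContinuous (fun x => b * U x) (fun x => b * V x) (fun x => b * (U x ^ 3 - U x))
    (fun x => (H.hasDerivAt x).const_mul b) (fun x => (H.hasDerivAt' x).const_mul b)
    (by have := H.continuous_U; fun_prop)

lemma plusForm_annihilates (H : IsCnoidal e T U V) (a x : ℝ) :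
    H.plusForm.P (H.derivJet a) x = 0 ∧ H.plusForm.Z (H.derivJet a) x = 0 := by
  have hn := H.one_sub_sq_ne_zero x
  have hV : V x = V x / (1 - U x ^ 2) * (1 - U x ^ 2) := by field_simp
  simp only [SquareForm.P, SquareForm.Z, plusForm, derivJet, H2Jet.ofContinuous]
  set ρ := V x / (1 - U x ^ 2)
  constructor
  · linear_combination (a * U x ^ 2) * hV
  · linear_combination (a * U x) * hV

lemma minusForm_annihilates (H : IsCnoidal e T U V) (b x : ℝ) :
    H.minusForm.P (H.selfJet b) x = 0 ∧ H.minusForm.Z (H.selfJet b) x = 0 := by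
  simp only [SquareForm.P, SquareForm.Z, minusForm, selfJet, H2Jet.ofContinuous]
  constructor <;> ring

/-- The kernel of `plusForm` is spanned by `U'`. -/
lemma exists_eq_mul_V (H : IsCnoidal e T U V) {f : H2Jet} (h : ∀ᵐ x, H.plusForm.sq f f x = 0) :
    ∃ a : ℝ, ∀ x, f.f₀ x = a * V x := by
  have hP : ∀ᵐ x, H.plusForm.P f x = 0 := h.mono fun x hx => (H.plusForm.sq_self_eq_zero hx).1
  have hZ : H.plusForm.Z f = fun _ => 0 :=
    ((H.plusForm.continuous_Z f).ae_eq_iff_eq volume continuous_const).1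
      (h.mono fun x hx => (H.plusForm.sq_self_eq_zero hx).2)
  have hV := H.V_zero_ne_zero
  -- As `U` vanishes at the origin, `Z f = 0` reads `V(0) f'(0) = 0` there. Since also `V'(0) = 0`,
  -- the Cauchy data are those of a multiple of `V`.
  have hZ0 := congrFun hZ 0
  simp only [SquareForm.Z, plusForm, H.zero] at hZ0
  have h1 : f.f₁ 0 = 0 := by simpa [hV] using hZ0
  refine ⟨f.f₀ 0 / V 0, fun x => ?_⟩
  refine congrFun (H.plusForm.eq_of_ae_P_eq_zero (k := H.derivJet (f.f₀ 0 / V 0)) hP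
    (Filter.Eventually.of_forall fun x => (H.plusForm_annihilates _ x).1) ?_ ?_) x
  · simp only [derivJet, H2Jet.ofContinuous]; field_simp
  · simp only [derivJet, H2Jet.ofContinuous, H.zero, h1]; ring

/-- The kernel of `minusForm` is spanned by `U`. -/
lemma exists_eq_mul_U (H : IsCnoidal e T U V) {f : H2Jet} (h : ∀ᵐ x, H.minusForm.sq f f x = 0) :
    ∃ b : ℝ, ∀ x, f.f₀ x = b * U x := by
  have hP : ∀ᵐ x, H.minusForm.P f x = 0 := h.mono fun x hx => (H.minusForm.sq_self_eq_zero hx).1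
  have hZ : H.minusForm.Z f = fun _ => 0 :=
    ((H.minusForm.continuous_Z f).ae_eq_iff_eq volume continuous_const).1
      (h.mono fun x hx => (H.minusForm.sq_self_eq_zero hx).2)
  have hV := H.V_zero_ne_zero
  -- Here `Z f = 0` at the origin reads `V(0) f(0) = 0`, which matches the Cauchy data of a multiple
  -- of `U`.
  have hZ0 := congrFun hZ 0
  simp only [SquareForm.Z, minusForm, H.zero] at hZ0
  have h0 : f.f₀ 0 = 0 := by simpa [hV] using hZ0
  refine ⟨f.f₁ 0 / V 0, fun x => ?_⟩
  refine congrFun (H.minusForm.eq_of_ae_P_eq_zero (k := H.selfJet (f.f₁ 0 / V 0)) hP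
    (Filter.Eventually.of_forall fun x => (H.minusForm_annihilates _ x).1) ?_ ?_) x
  · simp only [selfJet, H2Jet.ofContinuous, H.zero, h0]; ring
  · simp only [selfJet, H2Jet.ofContinuous]; field_simp

end IsCnoidal

/-! ### First and second variation of the density. -/

section Density

lemma norm_sq_eq (z : ℂ) : ‖z‖ ^ 2 = z.re * z.re + z.im * z.im := by
  rw [← Complex.normSq_eq_norm_sq, Complex.normSq_apply]

/-- The density of `Λ_c` in terms of `n = |ψ|²`, `n₁ = |ψ_x|²`, `n₂ = |ψ_xx|²` and
`m = Re (ψ̄ ψ_x)`. -/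
lemma lyapunovDensity_eq (e c : ℝ) (p p₁ p₂ : ℂ) : lyapunovDensity e c p p₁ p₂ =
    (p₂.re * p₂.re + p₂.im * p₂.im)
      + 3 * ((p.re * p.re + p.im * p.im) * (p₁.re * p₁.re + p₁.im * p₁.im))
      + 2 * (p.re * p₁.re + p.im * p₁.im) ^ 2 + 1 / 2 * (p.re * p.re + p.im * p.im) ^ 3
      - 1 / 2 * (3 - e ^ 2) * (p.re * p.re + p.im * p.im)
      - c * ((p₁.re * p₁.re + p₁.im * p₁.im) + 1 / 2 * (1 - (p.re * p.re + p.im * p.im)) ^ 2) := by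
  simp only [lyapunovDensity, higherDensity, chargeDensity, energyDensity]
  rw [show ‖p‖ ^ 6 = (‖p‖ ^ 2) ^ 3 by ring, norm_sq_eq, norm_sq_eq, norm_sq_eq]
  simp only [Complex.mul_re, Complex.conj_re, Complex.conj_im]
  ring

lemma hasDerivAt_affine (x a : ℝ) : HasDerivAt (fun t : ℝ => x + t * a) a 0 := by
  simpa using ((hasDerivAt_id' (0 : ℝ)).mul_const a).const_add x

/-- The first variation of the density. -/
lemma deriv_lyapunovDensity (e : ℝ) (p p₁ p₂ b b₁ b₂ : ℂ) :
    deriv (fun t : ℝ => lyapunovDensity e 2 (p + t * b) (p₁ + t * b₁) (p₂ + t * b₂)) 0 =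
      2 * (p₂.re * b₂.re + p₂.im * b₂.im)
        + 6 * ((p.re * b.re + p.im * b.im) * (p₁.re * p₁.re + p₁.im * p₁.im)
          + (p.re * p.re + p.im * p.im) * (p₁.re * b₁.re + p₁.im * b₁.im))
        + 4 * ((p.re * p₁.re + p.im * p₁.im)
          * (p.re * b₁.re + p₁.re * b.re + (p.im * b₁.im + p₁.im * b.im)))
        + 3 * ((p.re * p.re + p.im * p.im) ^ 2 * (p.re * b.re + p.im * b.im))
        - (3 - e ^ 2) * (p.re * b.re + p.im * b.im)
        - 4 * ((p₁.re * b₁.re + p₁.im * b₁.im)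
          - (1 - (p.re * p.re + p.im * p.im)) * (p.re * b.re + p.im * b.im)) := by
  simp only [lyapunovDensity_eq, Complex.add_re, Complex.add_im, Complex.re_ofReal_mul,
    Complex.im_ofReal_mul]
  have hx := hasDerivAt_affine p.re b.re
  have hy := hasDerivAt_affine p.im b.im
  have hx₁ := hasDerivAt_affine p₁.re b₁.re
  have hy₁ := hasDerivAt_affine p₁.im b₁.im
  have hx₂ := hasDerivAt_affine p₂.re b₂.re
  have hy₂ := hasDerivAt_affine p₂.im b₂.im
  have hn := (hx.fun_mul hx).fun_add (hy.fun_mul hy)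
  have hn₁ := (hx₁.fun_mul hx₁).fun_add (hy₁.fun_mul hy₁)
  have hn₂ := (hx₂.fun_mul hx₂).fun_add (hy₂.fun_mul hy₂)
  have hm := (hx.fun_mul hx₁).fun_add (hy.fun_mul hy₁)
  refine (((((hn₂.fun_add ((hn.fun_mul hn₁).const_mul 3)).fun_add
    ((hm.fun_pow 2).const_mul 2)).fun_add ((hn.fun_pow 3).const_mul (1 / 2))).fun_sub
    (hn.const_mul (1 / 2 * (3 - e ^ 2)))).fun_sub
    ((hn₁.fun_add (((hn.const_sub 1).fun_pow 2).const_mul (1 / 2))).const_mul 2)).deriv.trans ?_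
  push_cast
  ring

/-- The second variation of the density at a real base point. -/
lemma deriv_deriv_lyapunovDensity (e u v u₂ : ℝ) (a a₁ a₂ b b₁ b₂ : ℂ) :
    deriv (fun s : ℝ => deriv (fun t : ℝ => lyapunovDensity e 2
      ((u : ℂ) + s * a + t * b) ((v : ℂ) + s * a₁ + t * b₁) ((u₂ : ℂ) + s * a₂ + t * b₂)) 0) 0 =
    2 * ((a₂.re * b₂.re + (5 * u ^ 2 - 2) * (a₁.re * b₁.re)
        + 10 * u * v * (a.re * b₁.re + a₁.re * b.re)
        + (5 * v ^ 2 + 15 / 2 * u ^ 4 - (3 - e ^ 2) / 2 - 2 * (3 * u ^ 2 - 1)) * (a.re * b.re))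
      + (a₂.im * b₂.im + (3 * u ^ 2 - 2) * (a₁.im * b₁.im)
        + 2 * u * v * (a.im * b₁.im + a₁.im * b.im)
        + (3 * v ^ 2 + 3 / 2 * u ^ 4 - (3 - e ^ 2) / 2 - 2 * (u ^ 2 - 1)) * (a.im * b.im))) := by
  simp only [deriv_lyapunovDensity, Complex.add_re, Complex.add_im, Complex.re_ofReal_mul,
    Complex.im_ofReal_mul, Complex.ofReal_re, Complex.ofReal_im]
  have hx := hasDerivAt_affine u a.re
  have hy := hasDerivAt_affine 0 a.im
  have hx₁ := hasDerivAt_affine v a₁.re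
  have hy₁ := hasDerivAt_affine 0 a₁.im
  have hx₂ := hasDerivAt_affine u₂ a₂.re
  have hy₂ := hasDerivAt_affine 0 a₂.im
  have hn := (hx.fun_mul hx).fun_add (hy.fun_mul hy)
  have hn₁ := (hx₁.fun_mul hx₁).fun_add (hy₁.fun_mul hy₁)
  have hm := (hx.fun_mul hx₁).fun_add (hy.fun_mul hy₁)
  have hβ := (hx.mul_const b.re).fun_add (hy.mul_const b.im)
  have hβ₁ := (hx₁.mul_const b₁.re).fun_add (hy₁.mul_const b₁.im)
  have hβ₂ := (hx₂.mul_const b₂.re).fun_add (hy₂.mul_const b₂.im)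
  have hμ := ((hx.mul_const b₁.re).fun_add (hx₁.mul_const b.re)).fun_add
    ((hy.mul_const b₁.im).fun_add (hy₁.mul_const b.im))
  refine ((((((hβ₂.const_mul 2).fun_add
    (((hβ.fun_mul hn₁).fun_add (hn.fun_mul hβ₁)).const_mul 6)).fun_add
    ((hm.fun_mul hμ).const_mul 4)).fun_add (((hn.fun_pow 2).fun_mul hβ).const_mul 3)).fun_sub
    (hβ.const_mul (3 - e ^ 2))).fun_sub
    ((hβ₁.fun_sub ((hn.const_sub 1).fun_mul hβ)).const_mul 4)).deriv.trans ?_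
  push_cast
  ring

end Density

/-! ### Integrals depending polynomially on a parameter. -/

section Polynomial

lemma iteratedDeriv_two_sextic (c₀ c₁ c₂ c₃ c₄ c₅ c₆ : ℝ) :
    iteratedDeriv 2 (fun x : ℝ => c₀ + x * c₁ + x ^ 2 * c₂ + x ^ 3 * c₃ + x ^ 4 * c₄ + x ^ 5 * c₅
      + x ^ 6 * c₆) 0 = 2 * c₂ := by
  have hp : ∀ (n : ℕ) (c x : ℝ), HasDerivAt (fun x : ℝ => x ^ n * c) (n * x ^ (n - 1) * c) x :=
    fun n c x => by simpa using (hasDerivAt_pow n x).mul_const c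
  have h1 : deriv (fun x : ℝ => c₀ + x * c₁ + x ^ 2 * c₂ + x ^ 3 * c₃ + x ^ 4 * c₄ + x ^ 5 * c₅
      + x ^ 6 * c₆) = fun x => c₁ + x ^ 1 * (2 * c₂) + x ^ 2 * (3 * c₃) + x ^ 3 * (4 * c₄)
        + x ^ 4 * (5 * c₅) + x ^ 5 * (6 * c₆) := by
    funext x
    refine (((((((hasDerivAt_id' x).mul_const c₁).const_add c₀).fun_add (hp 2 c₂ x)).fun_add
      (hp 3 c₃ x)).fun_add (hp 4 c₄ x)).fun_add (hp 5 c₅ x)).fun_add (hp 6 c₆ x) |>.deriv.trans ?_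
    push_cast
    ring
  rw [iteratedDeriv_succ, iteratedDeriv_one, h1]
  refine ((((((hp 1 (2 * c₂) 0).const_add c₁).fun_add (hp 2 _ 0)).fun_add (hp 3 _ 0)).fun_add
    (hp 4 _ 0)).fun_add (hp 5 _ 0)).deriv.trans ?_
  norm_num

lemma integral_sextic {c₀ c₁ c₂ c₃ c₄ c₅ c₆ : ℝ → ℝ} (l₀ : LocallyIntegrable c₀)
    (l₁ : LocallyIntegrable c₁) (l₂ : LocallyIntegrable c₂) (l₃ : LocallyIntegrable c₃)
    (l₄ : LocallyIntegrable c₄) (l₅ : LocallyIntegrable c₅) (l₆ : LocallyIntegrable c₆)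
    (a b ε : ℝ) :
    ∫ x in a..b, (c₀ x + ε * c₁ x + ε ^ 2 * c₂ x + ε ^ 3 * c₃ x + ε ^ 4 * c₄ x + ε ^ 5 * c₅ x
      + ε ^ 6 * c₆ x) =
    (∫ x in a..b, c₀ x) + ε * (∫ x in a..b, c₁ x) + ε ^ 2 * (∫ x in a..b, c₂ x)
      + ε ^ 3 * (∫ x in a..b, c₃ x) + ε ^ 4 * (∫ x in a..b, c₄ x) + ε ^ 5 * (∫ x in a..b, c₅ x)
      + ε ^ 6 * (∫ x in a..b, c₆ x) := by
  have i₀ := intervalIntegrable_of_locallyIntegrable l₀ a b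
  have i₁ := (intervalIntegrable_of_locallyIntegrable l₁ a b).const_mul ε
  have i₂ := (intervalIntegrable_of_locallyIntegrable l₂ a b).const_mul (ε ^ 2)
  have i₃ := (intervalIntegrable_of_locallyIntegrable l₃ a b).const_mul (ε ^ 3)
  have i₄ := (intervalIntegrable_of_locallyIntegrable l₄ a b).const_mul (ε ^ 4)
  have i₅ := (intervalIntegrable_of_locallyIntegrable l₅ a b).const_mul (ε ^ 5)
  have i₆ := (intervalIntegrable_of_locallyIntegrable l₆ a b).const_mul (ε ^ 6)
  have j₁ := i₀.add i₁
  have j₂ := j₁.add i₂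
  have j₃ := j₂.add i₃
  have j₄ := j₃.add i₄
  have j₅ := j₄.add i₅
  rw [intervalIntegral.integral_add j₅ i₆, intervalIntegral.integral_add j₄ i₅,
    intervalIntegral.integral_add j₃ i₄, intervalIntegral.integral_add j₂ i₃,
    intervalIntegral.integral_add j₁ i₂, intervalIntegral.integral_add i₀ i₁]
  simp only [intervalIntegral.integral_const_mul]

end Polynomial

/-! ### Real coordinates of complex `H²_loc` functions. -/

section Complex

variable {w : ℝ → ℂ}

lemma MemH2Loc.hasDerivAt (hw : MemH2Loc w) (x : ℝ) : HasDerivAt w (deriv w x) x :=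
  (hw.contDiff.differentiable (by norm_num) x).hasDerivAt

lemma MemH2Loc.continuous_deriv (hw : MemH2Loc w) : Continuous (deriv w) :=
  hw.contDiff.continuous_deriv le_rfl

lemma MemH2Loc.loc (hw : MemH2Loc w) : LocallyIntegrable (deriv (deriv w)) := fun x =>
  ⟨Icc (x - 1) (x + 1), Icc_mem_nhds (by linarith) (by linarith),
    (hw.memLp (x - 1) (x + 1)).integrable (by norm_num)⟩

lemma MemH2Loc.loc_sq (hw : MemH2Loc w) : LocallyIntegrable fun x => ‖deriv (deriv w) x‖ ^ 2 :=
  fun x => ⟨Icc (x - 1) (x + 1), Icc_mem_nhds (by linarith) (by linarith),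
    (hw.memLp (x - 1) (x + 1)).norm.integrable_sq⟩

lemma MemH2Loc.ae_hasDerivAt (hw : MemH2Loc w) :
    ∀ᵐ x, HasDerivAt (deriv w) (deriv (deriv w) x) x := by
  have e : deriv w = fun x => (∫ t in (0 : ℝ)..x, deriv (deriv w) t) + deriv w 0 := by
    funext x; rw [hw.ftc]; ring
  filter_upwards [LocallyIntegrable.ae_hasDerivAt_integral hw.loc] with x hx
  have := (hx 0).add_const (deriv w 0)
  rwa [← e] at this

/-- The jet of a real coordinate of a complex function of class `H²_loc`. -/
@[simps] noncomputable def MemH2Loc.jet (hw : MemH2Loc w) (L : ℂ →L[ℝ] ℝ) : H2Jet where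
  f₀ x := L (w x)
  f₁ x := L (deriv w x)
  f₂ x := L (deriv (deriv w) x)
  hasDerivAt x := L.hasFDerivAt.comp_hasDerivAt x (hw.hasDerivAt x)
  prim := by
    refine ⟨fun x => ?_, fun a b => ?_⟩
    · obtain ⟨s, hs, hi⟩ := hw.loc x
      exact ⟨s, hs, L.integrable_comp hi⟩
    · have hi : IntervalIntegrable (deriv (deriv w)) volume a b := intervalIntegrable_iff.mpr <|
        (hw.loc.integrableOn_isCompact isCompact_uIcc).mono_set uIoc_subset_uIcc
      rw [L.intervalIntegral_comp_comm hi, hw.ftc, map_sub]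
  sq := by
    refine (hw.loc_sq.smul (‖L‖ ^ 2)).mono
      ((L.continuous.comp_aestronglyMeasurable hw.loc.aestronglyMeasurable).pow 2)
      (Filter.Eventually.of_forall fun x => ?_)
    rw [norm_pow, Pi.smul_apply, smul_eq_mul, ← mul_pow, norm_pow, norm_mul, norm_norm, norm_norm]
    exact pow_le_pow_left₀ (norm_nonneg _) (L.le_opNorm _) 2

lemma deriv_periodic {E : Type*} [NormedAddCommGroup E] [NormedSpace ℝ E] {f : ℝ → E} {T : ℝ}
    (h : Function.Periodic f T) : Function.Periodic (deriv f) T := fun x => by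
  rw [← deriv_comp_add_const, show (fun x => f (x + T)) = f from funext h]

end Complex

/-! ### The second variation in terms of the two forms, on the line and on periods. -/

section Wave

variable {ℰ : ℝ}

lemma deriv_wave (h₀ : 0 < ℰ) (h₁ : ℰ < 1) :
    deriv (wave ℰ) = fun x => (profileDeriv ℰ x : ℂ) :=
  funext fun x => ((isCnoidal_profile h₀ h₁).hasDerivAt x).ofReal_comp.deriv

lemma hasDerivAt_wave (h₀ : 0 < ℰ) (h₁ : ℰ < 1) (x : ℝ) :
    HasDerivAt (wave ℰ) (profileDeriv ℰ x : ℂ) x :=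
  ((isCnoidal_profile h₀ h₁).hasDerivAt x).ofReal_comp

lemma hasDerivAt_deriv_wave (h₀ : 0 < ℰ) (h₁ : ℰ < 1) (x : ℝ) :
    HasDerivAt (deriv (wave ℰ)) ((profile ℰ x ^ 3 - profile ℰ x : ℝ) : ℂ) x := by
  rw [deriv_wave h₀ h₁]
  exact ((isCnoidal_profile h₀ h₁).hasDerivAt' x).ofReal_comp

/-- The second variation on the line is twice the sum of the forms on the real and imaginary
parts. -/
lemma secondVariationLine_eq (h₀ : 0 < ℰ) (h₁ : ℰ < 1) {w φ : ℝ → ℂ} (hw : MemH2Loc w)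
    (f h : H2Jet) (hf₀ : ∀ x, f.f₀ x = (φ x).re) (hf₁ : ∀ x, f.f₁ x = (deriv φ x).re)
    (hf₂ : ∀ x, f.f₂ x = (deriv (deriv φ) x).re) (hh₀ : ∀ x, h.f₀ x = (φ x).im)
    (hh₁ : ∀ x, h.f₁ x = (deriv φ x).im) (hh₂ : ∀ x, h.f₂ x = (deriv (deriv φ) x).im) :
    secondVariationLine ℰ 2 w φ = ∫ x, 2 *
      ((isCnoidal_profile h₀ h₁).plusForm.form (hw.jet Complex.reCLM) f x
        + (isCnoidal_profile h₀ h₁).minusForm.form (hw.jet Complex.imCLM) h x) := by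
  unfold secondVariationLine
  congr 1
  funext x
  rw [IsCnoidal.plusForm_form, IsCnoidal.minusForm_form, hf₀, hf₁, hf₂, hh₀, hh₁, hh₂,
    (hasDerivAt_deriv_wave h₀ h₁ x).deriv, deriv_wave h₀ h₁]
  exact deriv_deriv_lyapunovDensity ℰ _ _ _ _ _ _ _ _ _

end Wave

section PeriodicVariation

/-- The density along a line through a real base point is a polynomial of degree six. -/
lemma lyapunovDensity_line (e u v u₂ ε : ℝ) (a a₁ a₂ : ℂ) :
    lyapunovDensity e 2 ((u : ℂ) + ε * a) ((v : ℂ) + ε * a₁) ((u₂ : ℂ) + ε * a₂) =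
      (u₂ ^ 2 + 3 * (u ^ 2 * v ^ 2) + 2 * (u * v) ^ 2 + 1 / 2 * u ^ 6 - 1 / 2 * (3 - e ^ 2) * u ^ 2
        - 2 * (v ^ 2 + 1 / 2 * (1 - u ^ 2) ^ 2))
      + ε * (2 * u₂ * a₂.re + (6 * (u * a.re * v ^ 2 + u ^ 2 * (v * a₁.re))
        + 4 * (u * v * (u * a₁.re + v * a.re)) + 3 * (u ^ 4 * (u * a.re))
        - (3 - e ^ 2) * (u * a.re) - 4 * (v * a₁.re - (1 - u ^ 2) * (u * a.re))))
      + ε ^ 2 * ((a₂.re * a₂.re + (5 * u ^ 2 - 2) * (a₁.re * a₁.re)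
        + 10 * u * v * (a.re * a₁.re + a₁.re * a.re)
        + (5 * v ^ 2 + 15 / 2 * u ^ 4 - (3 - e ^ 2) / 2 - 2 * (3 * u ^ 2 - 1)) * (a.re * a.re))
      + (a₂.im * a₂.im + (3 * u ^ 2 - 2) * (a₁.im * a₁.im)
        + 2 * u * v * (a.im * a₁.im + a₁.im * a.im)
        + (3 * v ^ 2 + 3 / 2 * u ^ 4 - (3 - e ^ 2) / 2 - 2 * (u ^ 2 - 1)) * (a.im * a.im)))
      + ε ^ 3 * (6 * (u * a.re * (a₁.re ^ 2 + a₁.im ^ 2) + v * a₁.re * (a.re ^ 2 + a.im ^ 2))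
        + 4 * ((u * a₁.re + v * a.re) * (a.re * a₁.re + a.im * a₁.im))
        + 6 * (u ^ 3 * a.re * (a.re ^ 2 + a.im ^ 2)) + 4 * (u * a.re) ^ 3
        - 4 * (u * a.re * (a.re ^ 2 + a.im ^ 2)))
      + ε ^ 4 * (3 * ((a.re ^ 2 + a.im ^ 2) * (a₁.re ^ 2 + a₁.im ^ 2))
        + 2 * (a.re * a₁.re + a.im * a₁.im) ^ 2 + 3 / 2 * (u ^ 2 * (a.re ^ 2 + a.im ^ 2) ^ 2)
        + 6 * ((u * a.re) ^ 2 * (a.re ^ 2 + a.im ^ 2)) - (a.re ^ 2 + a.im ^ 2) ^ 2)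
      + ε ^ 5 * (3 * (u * a.re * (a.re ^ 2 + a.im ^ 2) ^ 2))
      + ε ^ 6 * (1 / 2 * (a.re ^ 2 + a.im ^ 2) ^ 3) := by
  simp only [lyapunovDensity_eq, Complex.add_re, Complex.add_im, Complex.re_ofReal_mul,
    Complex.im_ofReal_mul, Complex.ofReal_re, Complex.ofReal_im]
  ring

/-- The functionals are defined by separate integrals; each density is integrable on the bounded
interval, so they may be merged into one. -/
lemma lyapunov_eq_functional {ψ : ℝ → ℂ} (hψ : MemH2Loc ψ) (e c T : ℝ) :
    lyapunov e c (Ioo 0 T) ψ = functional (lyapunovDensity e c) (Ioo 0 T) ψ := by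
  have c₀ := hψ.contDiff.continuous
  have c₁ := hψ.continuous_deriv
  have hI : ∀ {k : ℝ → ℝ}, LocallyIntegrable k → IntegrableOn k (Ioo 0 T) := fun hk =>
    (hk.integrableOn_isCompact isCompact_Icc).mono_set Ioo_subset_Icc_self
  have iQ : IntegrableOn (fun x => chargeDensity (ψ x) (deriv ψ x) (deriv (deriv ψ) x))
      (Ioo 0 T) := by
    refine hI (Continuous.locallyIntegrable ?_)
    unfold chargeDensity
    fun_prop
  have iE : IntegrableOn (fun x => energyDensity (ψ x) (deriv ψ x) (deriv (deriv ψ) x))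
      (Ioo 0 T) := by
    refine hI (Continuous.locallyIntegrable ?_)
    unfold energyDensity
    fun_prop
  have iR : IntegrableOn (fun x => higherDensity (ψ x) (deriv ψ x) (deriv (deriv ψ) x))
      (Ioo 0 T) := by
    have hc : Continuous fun x => 3 * ‖ψ x‖ ^ 2 * ‖deriv ψ x‖ ^ 2
        + 1 / 2 * (2 * (starRingEnd ℂ (ψ x) * deriv ψ x).re) ^ 2 + 1 / 2 * ‖ψ x‖ ^ 6 := by
      have : Continuous fun x => (starRingEnd ℂ (ψ x) * deriv ψ x).re :=
        Complex.continuous_re.comp ((Complex.continuous_conj.comp c₀).mul c₁)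
      fun_prop
    refine hI ((hψ.loc_sq.add hc.locallyIntegrable).congr
      (Filter.Eventually.of_forall fun x => ?_))
    simp only [higherDensity, Pi.add_apply]
    ring
  simp only [lyapunov, higherS, higherR, chargeQ, energyE, functional, lyapunovDensity]
  have iS : IntegrableOn (fun x => higherDensity (ψ x) (deriv ψ x) (deriv (deriv ψ) x)
      - 1 / 2 * (3 - e ^ 2) * chargeDensity (ψ x) (deriv ψ x) (deriv (deriv ψ) x)) (Ioo 0 T) :=
    iR.sub (iQ.const_mul _)
  rw [integral_sub iS (iE.const_mul _), integral_sub iR (iQ.const_mul _),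
    integral_const_mul, integral_const_mul]

variable {ℰ : ℝ}

/-- The second derivative is additive only almost everywhere, since `w'` is merely absolutely
continuous. -/
lemma ae_deriv_deriv_wave_add (h₀ : 0 < ℰ) (h₁ : ℰ < 1) {w : ℝ → ℂ} (hw : MemH2Loc w) (ε : ℝ) :
    (∀ x, deriv (fun x => wave ℰ x + ε * w x) x = profileDeriv ℰ x + ε * deriv w x) ∧
    ∀ᵐ x, deriv (deriv fun x => wave ℰ x + ε * w x) x =
      ((profile ℰ x ^ 3 - profile ℰ x : ℝ) : ℂ) + ε * deriv (deriv w) x := by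
  have hd : ∀ x, deriv (fun x => wave ℰ x + ε * w x) x = profileDeriv ℰ x + ε * deriv w x :=
    fun x => ((hasDerivAt_wave h₀ h₁ x).add ((hw.hasDerivAt x).const_mul (ε : ℂ))).deriv
  refine ⟨hd, ?_⟩
  filter_upwards [hw.ae_hasDerivAt] with x hx
  rw [funext hd]
  have := hasDerivAt_deriv_wave h₀ h₁ x
  rw [deriv_wave h₀ h₁] at this
  exact (this.add (hx.const_mul (ε : ℂ))).deriv

lemma memH2Loc_wave_add (h₀ : 0 < ℰ) (h₁ : ℰ < 1) {w : ℝ → ℂ} (hw : MemH2Loc w) (ε : ℝ) :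
    MemH2Loc fun x => wave ℰ x + ε * w x := by
  have H := isCnoidal_profile h₀ h₁
  obtain ⟨hd, hdd⟩ := ae_deriv_deriv_wave_add h₀ h₁ hw ε
  have cV : Continuous fun x => (profileDeriv ℰ x : ℂ) :=
    Complex.continuous_ofReal.comp H.continuous_V
  have cU : Continuous fun x => ((profile ℰ x ^ 3 - profile ℰ x : ℝ) : ℂ) :=
    Complex.continuous_ofReal.comp ((H.continuous_U.pow 3).sub H.continuous_U)
  refine ⟨?_, fun a b => ?_, fun a b => ?_⟩
  · rw [contDiff_one_iff_deriv]
    refine ⟨fun x => ((hasDerivAt_wave h₀ h₁ x).add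
      ((hw.hasDerivAt x).const_mul (ε : ℂ))).differentiableAt, ?_⟩
    rw [funext hd]
    exact cV.add (continuous_const.mul hw.continuous_deriv)
  · refine MemLp.ae_eq (f := fun x => ((profile ℰ x ^ 3 - profile ℰ x : ℝ) : ℂ)
      + ε * deriv (deriv w) x) ?_ ?_
    · exact (ae_restrict_of_ae hdd).mono fun x hx => hx.symm
    · obtain ⟨C, hC⟩ := isCompact_Icc.exists_bound_of_continuousOn (s := Icc a b) cU.continuousOn
      have hU : MemLp (fun x => ((profile ℰ x ^ 3 - profile ℰ x : ℝ) : ℂ)) 2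
          (volume.restrict (Icc a b)) := .of_bound cU.aestronglyMeasurable C
        ((ae_restrict_iff' measurableSet_Icc).2 (Filter.Eventually.of_forall hC))
      exact hU.add ((hw.memLp a b).const_mul _)
  · have hi : IntervalIntegrable (deriv (deriv w)) volume a b := intervalIntegrable_iff.mpr <|
      (hw.loc.integrableOn_isCompact isCompact_uIcc).mono_set uIoc_subset_uIcc
    rw [intervalIntegral.integral_congr_ae (g := fun x =>
      ((profile ℰ x ^ 3 - profile ℰ x : ℝ) : ℂ) + ε * deriv (deriv w) x)
      (by filter_upwards [hdd] with x hx _; exact hx),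
      intervalIntegral.integral_add (cU.intervalIntegrable _ _) (hi.const_mul _),
      intervalIntegral.integral_const_mul, hw.ftc,
      intervalIntegral.integral_eq_sub_of_hasDerivAt
        (fun x _ => hasDerivAt_deriv_wave h₀ h₁ x) (cU.intervalIntegrable _ _),
      hd, hd, deriv_wave h₀ h₁]
    ring

/-- The second variation on periodic functions is twice the sum of the forms on the real and
imaginary parts. -/
lemma secondVariationPer_eq (h₀ : 0 < ℰ) (h₁ : ℰ < 1) {w : ℝ → ℂ} (hw : MemH2Loc w) {T : ℝ}
    (hT : 0 ≤ T) :
    secondVariationPer ℰ 2 T w = 2 * ∫ x in 0..T,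
      ((isCnoidal_profile h₀ h₁).plusForm.form (hw.jet Complex.reCLM) (hw.jet Complex.reCLM) x
        + (isCnoidal_profile h₀ h₁).minusForm.form (hw.jet Complex.imCLM)
          (hw.jet Complex.imCLM) x) := by
  have H := isCnoidal_profile h₀ h₁
  have cU := H.continuous_U
  have cV := H.continuous_V
  have cr : Continuous fun x => (w x).re := Complex.continuous_re.comp hw.contDiff.continuous
  have ci : Continuous fun x => (w x).im := Complex.continuous_im.comp hw.contDiff.continuous
  have cr₁ : Continuous fun x => (deriv w x).re := Complex.continuous_re.comp hw.continuous_deriv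
  have ci₁ : Continuous fun x => (deriv w x).im := Complex.continuous_im.comp hw.continuous_deriv
  have l₂ := (H.plusForm.loc_form (hw.jet Complex.reCLM) (hw.jet Complex.reCLM)).add
    (H.minusForm.loc_form (hw.jet Complex.imCLM) (hw.jet Complex.imCLM))
  have lre : LocallyIntegrable fun x => (deriv (deriv w) x).re := (hw.jet Complex.reCLM).prim.loc
  -- The integrand is a polynomial of degree six in `ε` with locally integrable coefficients, so the
  -- functional is itself a polynomial in `ε` and no differentiation under the integral is required.
  have hpoly : ∀ ε : ℝ, lyapunov ℰ 2 (Ioo 0 T) (fun x => wave ℰ x + ε * w x) =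
      ∫ x in 0..T, lyapunovDensity ℰ 2 ((profile ℰ x : ℂ) + ε * w x)
        ((profileDeriv ℰ x : ℂ) + ε * deriv w x)
        (((profile ℰ x ^ 3 - profile ℰ x : ℝ) : ℂ) + ε * deriv (deriv w) x) := fun ε => by
    obtain ⟨hd, hdd⟩ := ae_deriv_deriv_wave_add h₀ h₁ hw ε
    rw [lyapunov_eq_functional (memH2Loc_wave_add h₀ h₁ hw ε), functional,
      intervalIntegral.integral_of_le hT, integral_Ioc_eq_integral_Ioo]
    refine integral_congr_ae (ae_restrict_of_ae ?_)
    filter_upwards [hdd] with x hx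
    rw [hx, hd]
    rfl
  unfold secondVariationPer
  simp only [hpoly, lyapunovDensity_line]
  have k₁ : Continuous fun x => 2 * (profile ℰ x ^ 3 - profile ℰ x) := by fun_prop
  have q : ∀ x, (deriv (deriv w) x).re * (deriv (deriv w) x).re
        + (5 * profile ℰ x ^ 2 - 2) * ((deriv w x).re * (deriv w x).re)
        + 10 * profile ℰ x * profileDeriv ℰ x
          * ((w x).re * (deriv w x).re + (deriv w x).re * (w x).re)
        + (5 * profileDeriv ℰ x ^ 2 + 15 / 2 * profile ℰ x ^ 4 - (3 - ℰ ^ 2) / 2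
          - 2 * (3 * profile ℰ x ^ 2 - 1)) * ((w x).re * (w x).re)
      + ((deriv (deriv w) x).im * (deriv (deriv w) x).im
        + (3 * profile ℰ x ^ 2 - 2) * ((deriv w x).im * (deriv w x).im)
        + 2 * profile ℰ x * profileDeriv ℰ x
          * ((w x).im * (deriv w x).im + (deriv w x).im * (w x).im)
        + (3 * profileDeriv ℰ x ^ 2 + 3 / 2 * profile ℰ x ^ 4 - (3 - ℰ ^ 2) / 2
          - 2 * (profile ℰ x ^ 2 - 1)) * ((w x).im * (w x).im))
      = H.plusForm.form (hw.jet Complex.reCLM) (hw.jet Complex.reCLM) x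
        + H.minusForm.form (hw.jet Complex.imCLM) (hw.jet Complex.imCLM) x := fun x => by
    rw [H.plusForm_form, H.minusForm_form]
    rfl
  simp only [q]
  have hintegral := fun ε : ℝ => integral_sextic (a := 0) (b := T) (ε := ε)
    (c₀ := fun x => (profile ℰ x ^ 3 - profile ℰ x) ^ 2
      + 3 * (profile ℰ x ^ 2 * profileDeriv ℰ x ^ 2) + 2 * (profile ℰ x * profileDeriv ℰ x) ^ 2
      + 1 / 2 * profile ℰ x ^ 6 - 1 / 2 * (3 - ℰ ^ 2) * profile ℰ x ^ 2
      - 2 * (profileDeriv ℰ x ^ 2 + 1 / 2 * (1 - profile ℰ x ^ 2) ^ 2))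
    (Continuous.locallyIntegrable (by fun_prop))
    ((lre.continuous_mul k₁).add (Continuous.locallyIntegrable
      (f := fun x => 6 * (profile ℰ x * (w x).re * profileDeriv ℰ x ^ 2
          + profile ℰ x ^ 2 * (profileDeriv ℰ x * (deriv w x).re))
        + 4 * (profile ℰ x * profileDeriv ℰ x * (profile ℰ x * (deriv w x).re
          + profileDeriv ℰ x * (w x).re)) + 3 * (profile ℰ x ^ 4 * (profile ℰ x * (w x).re))
        - (3 - ℰ ^ 2) * (profile ℰ x * (w x).re) - 4 * (profileDeriv ℰ x * (deriv w x).re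
          - (1 - profile ℰ x ^ 2) * (profile ℰ x * (w x).re))) (by fun_prop)))
    l₂
    (Continuous.locallyIntegrable (f := fun x =>
      6 * (profile ℰ x * (w x).re * ((deriv w x).re ^ 2 + (deriv w x).im ^ 2)
        + profileDeriv ℰ x * (deriv w x).re * ((w x).re ^ 2 + (w x).im ^ 2))
      + 4 * ((profile ℰ x * (deriv w x).re + profileDeriv ℰ x * (w x).re)
        * ((w x).re * (deriv w x).re + (w x).im * (deriv w x).im))
      + 6 * (profile ℰ x ^ 3 * (w x).re * ((w x).re ^ 2 + (w x).im ^ 2))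
      + 4 * (profile ℰ x * (w x).re) ^ 3
      - 4 * (profile ℰ x * (w x).re * ((w x).re ^ 2 + (w x).im ^ 2))) (by fun_prop))
    (Continuous.locallyIntegrable (f := fun x =>
      3 * (((w x).re ^ 2 + (w x).im ^ 2) * ((deriv w x).re ^ 2 + (deriv w x).im ^ 2))
      + 2 * ((w x).re * (deriv w x).re + (w x).im * (deriv w x).im) ^ 2
      + 3 / 2 * (profile ℰ x ^ 2 * ((w x).re ^ 2 + (w x).im ^ 2) ^ 2)
      + 6 * ((profile ℰ x * (w x).re) ^ 2 * ((w x).re ^ 2 + (w x).im ^ 2))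
      - ((w x).re ^ 2 + (w x).im ^ 2) ^ 2) (by fun_prop))
    (Continuous.locallyIntegrable (f := fun x =>
      3 * (profile ℰ x * (w x).re * ((w x).re ^ 2 + (w x).im ^ 2) ^ 2)) (by fun_prop))
    (Continuous.locallyIntegrable (f := fun x =>
      1 / 2 * ((w x).re ^ 2 + (w x).im ^ 2) ^ 3) (by fun_prop))
  simp only [Pi.add_apply] at hintegral
  simp only [hintegral]
  exact iteratedDeriv_two_sextic _ _ _ _ _ _ _

end PeriodicVariation

/-! ### Neutral directions. -/

section Neutral

variable {ℰ : ℝ} {w : ℝ → ℂ}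

lemma isNeutral_of_ae_sq_eq_zero (h₀ : 0 < ℰ) (h₁ : ℰ < 1) (hw : MemH2Loc w)
    (hp : ∀ᵐ x, (isCnoidal_profile h₀ h₁).plusForm.sq (hw.jet Complex.reCLM)
      (hw.jet Complex.reCLM) x = 0)
    (hm : ∀ᵐ x, (isCnoidal_profile h₀ h₁).minusForm.sq (hw.jet Complex.imCLM)
      (hw.jet Complex.imCLM) x = 0) : IsNeutral ℰ w := by
  obtain ⟨a, ha⟩ := (isCnoidal_profile h₀ h₁).exists_eq_mul_V hp
  obtain ⟨b, hb⟩ := (isCnoidal_profile h₀ h₁).exists_eq_mul_U hm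
  refine ⟨a, b, fun x => ?_⟩
  rw [deriv_wave h₀ h₁, wave]
  have ha' : (w x).re = a * profileDeriv ℰ x := ha x
  have hb' : (w x).im = b * profile ℰ x := hb x
  apply Complex.ext
  · simp [ha']
  · simp [hb']

/-- `P` and `Z` annihilate the neutral jets, so the product vanishes whatever the second argument
is. This serves both the equality case on periods and the weak equation on the line. -/
lemma IsNeutral.sq_eq_zero (h₀ : 0 < ℰ) (h₁ : ℰ < 1) (hw : MemH2Loc w) (hn : IsNeutral ℰ w)
    (f : H2Jet) (x : ℝ) :
    (isCnoidal_profile h₀ h₁).plusForm.sq (hw.jet Complex.reCLM) f x = 0 ∧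
      (isCnoidal_profile h₀ h₁).minusForm.sq (hw.jet Complex.imCLM) f x = 0 := by
  obtain ⟨a, b, hab⟩ := hn
  have H := isCnoidal_profile h₀ h₁
  have e₀ : w = fun x => ((a * profileDeriv ℰ x : ℝ) : ℂ)
      + Complex.I * ((b * profile ℰ x : ℝ) : ℂ) := by
    funext x
    rw [hab, deriv_wave h₀ h₁, wave]
    push_cast
    ring
  have hd : ∀ p q : H2Jet, (∀ x, deriv (fun x => (p.f₀ x : ℂ) + Complex.I * (q.f₀ x : ℂ)) x
      = (p.f₁ x : ℂ) + Complex.I * (q.f₁ x : ℂ)) := fun p q x =>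
    ((p.hasDerivAt x).ofReal_comp.add ((q.hasDerivAt x).ofReal_comp.const_mul Complex.I)).deriv
  have e₁ : deriv w =
      fun x => ((H.derivJet a).f₁ x : ℂ) + Complex.I * ((H.selfJet b).f₁ x : ℂ) := by
    rw [e₀]
    exact funext (hd (H.derivJet a) (H.selfJet b))
  have e₂ : deriv (deriv w) =
      fun x => ((H.derivJet a).f₂ x : ℂ) + Complex.I * ((H.selfJet b).f₂ x : ℂ) := by
    rw [e₁]
    funext x
    have d₁ : HasDerivAt (H.derivJet a).f₁ ((H.derivJet a).f₂ x) x :=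
      ((((H.hasDerivAt x).fun_pow 3).fun_sub (H.hasDerivAt x)).const_mul a).congr_deriv
        (by simp only [IsCnoidal.derivJet, H2Jet.ofContinuous]; push_cast; ring)
    have d₂ : HasDerivAt (H.selfJet b).f₁ ((H.selfJet b).f₂ x) x := (H.hasDerivAt' x).const_mul b
    exact (d₁.ofReal_comp.add (d₂.ofReal_comp.const_mul Complex.I)).deriv
  have r : ∀ s t : ℝ, ((s : ℂ) + Complex.I * (t : ℂ)).re = s := fun s t => by simp
  have i : ∀ s t : ℝ, ((s : ℂ) + Complex.I * (t : ℂ)).im = t := fun s t => by simp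
  have pP : H.plusForm.P (hw.jet Complex.reCLM) x = H.plusForm.P (H.derivJet a) x := by
    simp only [SquareForm.P, MemH2Loc.jet_f₀, MemH2Loc.jet_f₁, MemH2Loc.jet_f₂,
      Complex.reCLM_apply, e₂, r]
    simp only [e₁, r]
    rw [e₀, r]
    rfl
  have pZ : H.plusForm.Z (hw.jet Complex.reCLM) x = H.plusForm.Z (H.derivJet a) x := by
    simp only [SquareForm.Z, MemH2Loc.jet_f₀, MemH2Loc.jet_f₁, Complex.reCLM_apply, e₁, r]
    rw [e₀, r]
    rfl
  have mP : H.minusForm.P (hw.jet Complex.imCLM) x = H.minusForm.P (H.selfJet b) x := by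
    simp only [SquareForm.P, MemH2Loc.jet_f₀, MemH2Loc.jet_f₁, MemH2Loc.jet_f₂,
      Complex.imCLM_apply, e₂, i]
    simp only [e₁, i]
    rw [e₀, i]
    rfl
  have mZ : H.minusForm.Z (hw.jet Complex.imCLM) x = H.minusForm.Z (H.selfJet b) x := by
    simp only [SquareForm.Z, MemH2Loc.jet_f₀, MemH2Loc.jet_f₁, Complex.imCLM_apply, e₁, i]
    rw [e₀, i]
    rfl
  unfold SquareForm.sq
  rw [pP, pZ, mP, mZ, (H.plusForm_annihilates a x).1, (H.plusForm_annihilates a x).2,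
    (H.minusForm_annihilates b x).1, (H.minusForm_annihilates b x).2]
  simp

/-- A square-integrable neutral direction vanishes. -/
lemma IsNeutral.eq_zero_of_memLp (h₀ : 0 < ℰ) (h₁ : ℰ < 1) (hw : Continuous w)
    (hn : IsNeutral ℰ w) (hL : MemLp w 2) : w = 0 := by
  obtain ⟨a, b, hab⟩ := hn
  have H := isCnoidal_profile h₀ h₁
  have hper : Function.Periodic (fun x => ‖w x‖ ^ 2) (period ℰ) := fun x => by
    simp only [hab, deriv_wave h₀ h₁, wave, H.periodic x, H.periodic' x]
  have hc : Continuous fun x => ‖w x‖ ^ 2 := by fun_prop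
  have hi : Integrable fun x => ‖w x‖ ^ 2 := hL.norm.integrable_sq
  have hT := H.period_pos
  have hn : ∀ n : ℕ, ∫ x in -(n * period ℰ)..(n * period ℰ), ‖w x‖ ^ 2
      = 2 * n * ∫ x in 0..(period ℰ), ‖w x‖ ^ 2 := fun n => by
    have e := hper.intervalIntegral_add_zsmul_eq (2 * n : ℤ) (-(n * period ℰ))
      (fun _ _ => hc.intervalIntegrable _ _)
    have e2 : -(n * period ℰ) + (2 * n : ℤ) • period ℰ = n * period ℰ := by
      rw [zsmul_eq_mul]; push_cast; ring
    have e3 := hper.intervalIntegral_add_eq (-(n * period ℰ)) 0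
    rw [zero_add] at e3
    rw [e2, e3, zsmul_eq_mul] at e
    rw [e]
    push_cast
    ring
  -- The mass of `2 n` periods is bounded by the finite total mass for every `n`, so the mass of one
  -- period is zero.
  have hle : ∀ n : ℕ, 2 * n * ∫ x in 0..(period ℰ), ‖w x‖ ^ 2 ≤ ∫ x, ‖w x‖ ^ 2 := fun n => by
    rw [← hn, intervalIntegral.integral_of_le (by
      have : 0 ≤ n * period ℰ := by positivity
      linarith)]
    exact setIntegral_le_integral hi (Filter.Eventually.of_forall fun x => by positivity)
  have hI : ∫ x in 0..(period ℰ), ‖w x‖ ^ 2 ≤ 0 := by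
    by_contra hpos
    push Not at hpos
    obtain ⟨n, hn⟩ := exists_nat_gt ((∫ x, ‖w x‖ ^ 2) / ∫ x in 0..(period ℰ), ‖w x‖ ^ 2)
    rw [div_lt_iff₀ hpos] at hn
    have := hle n
    have : 0 ≤ n * ∫ x in 0..(period ℰ), ‖w x‖ ^ 2 := by positivity
    linarith
  have hae := ae_eq_zero_of_integral_le_zero hc.locallyIntegrable (fun x => by positivity)
    fun r => by
      obtain ⟨n, hr⟩ := exists_nat_gt (r / period ℰ)
      rw [div_lt_iff₀ hT] at hr
      refine ⟨n * period ℰ, hr.le, ?_⟩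
      rw [hn]
      exact mul_nonpos_of_nonneg_of_nonpos (by positivity) hI
  have := (hc.ae_eq_iff_eq volume continuous_const).1 hae
  funext x
  have hx := congrFun this x
  simpa using hx

end Neutral

/-! ### The three assertions. -/

section Main

variable {ℰ : ℝ} {w : ℝ → ℂ}

theorem secondVariationPer_nonneg_and_eq_zero_iff (h₀ : 0 < ℰ) (h₁ : ℰ < 1) {N : ℕ} (hN : 1 ≤ N)
    (hw : MemH2Per (N * period ℰ) w) :
    0 ≤ secondVariationPer ℰ 2 (N * period ℰ) w ∧
      (secondVariationPer ℰ 2 (N * period ℰ) w = 0 ↔ IsNeutral ℰ w) := by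
  have H := isCnoidal_profile h₀ h₁
  have hw' := hw.toMemH2Loc
  have p₀ := hw.periodic
  have p₁ := deriv_periodic p₀
  have p₂ := deriv_periodic p₁
  have hT : 0 ≤ N * period ℰ := mul_nonneg N.cast_nonneg H.period_pos.le
  have hp : ∫ x in 0..(N * period ℰ), H.plusForm.form (hw'.jet Complex.reCLM)
        (hw'.jet Complex.reCLM) x
      = ∫ x in 0..(N * period ℰ), H.plusForm.sq (hw'.jet Complex.reCLM)
        (hw'.jet Complex.reCLM) x :=
    H.plusForm.integral_form_periodic _ N (fun x => congrArg Complex.re (p₀ x))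
      fun x => congrArg Complex.re (p₁ x)
  have hm : ∫ x in 0..(N * period ℰ), H.minusForm.form (hw'.jet Complex.imCLM)
        (hw'.jet Complex.imCLM) x
      = ∫ x in 0..(N * period ℰ), H.minusForm.sq (hw'.jet Complex.imCLM)
        (hw'.jet Complex.imCLM) x :=
    H.minusForm.integral_form_periodic _ N (fun x => congrArg Complex.im (p₀ x))
      fun x => congrArg Complex.im (p₁ x)
  have np : 0 ≤ ∫ x in 0..(N * period ℰ), H.plusForm.sq (hw'.jet Complex.reCLM)
      (hw'.jet Complex.reCLM) x :=
    intervalIntegral.integral_nonneg hT fun x _ => H.plusForm.sq_self_nonneg _ x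
  have nm : 0 ≤ ∫ x in 0..(N * period ℰ), H.minusForm.sq (hw'.jet Complex.imCLM)
      (hw'.jet Complex.imCLM) x :=
    intervalIntegral.integral_nonneg hT fun x _ => H.minusForm.sq_self_nonneg _ x
  rw [secondVariationPer_eq h₀ h₁ hw' hT, intervalIntegral.integral_add
    (intervalIntegrable_of_locallyIntegrable (H.plusForm.loc_form _ _) _ _)
    (intervalIntegrable_of_locallyIntegrable (H.minusForm.loc_form _ _) _ _), hp, hm]
  refine ⟨by linarith, fun h => ?_, fun h => ?_⟩
  · have zp : ∫ x in 0..(N * period ℰ), H.plusForm.sq (hw'.jet Complex.reCLM)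
        (hw'.jet Complex.reCLM) x = 0 := by linarith
    have zm : ∫ x in 0..(N * period ℰ), H.minusForm.sq (hw'.jet Complex.imCLM)
        (hw'.jet Complex.imCLM) x = 0 := by linarith
    refine isNeutral_of_ae_sq_eq_zero h₀ h₁ hw' ?_ ?_
    · exact H.plusForm.ae_sq_eq_zero_of_periodic hN (fun x => congrArg Complex.re (p₀ x))
        (fun x => congrArg Complex.re (p₁ x)) (fun x => congrArg Complex.re (p₂ x))
        zp
    · exact H.minusForm.ae_sq_eq_zero_of_periodic hN (fun x => congrArg Complex.im (p₀ x))
        (fun x => congrArg Complex.im (p₁ x)) (fun x => congrArg Complex.im (p₂ x))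
        zm
  · simp only [(h.sq_eq_zero h₀ h₁ hw' _ _).1, (h.sq_eq_zero h₀ h₁ hw' _ _).2]
    simp

/-- A zero value would make both squares vanish and hence `w` neutral; a neutral direction in `L²`
is zero. -/
theorem secondVariationLine_pos (h₀ : 0 < ℰ) (h₁ : ℰ < 1) (hw : MemH2 w) (hne : w ≠ 0) :
    0 < secondVariationLine ℰ 2 w w := by
  have H := isCnoidal_profile h₀ h₁
  have hw' := hw.toMemH2Loc
  obtain ⟨ip, isp, ep⟩ := H.plusForm.integral_form_memLp (hw'.jet Complex.reCLM)
    (Complex.reCLM.comp_memLp' hw.memLp_zero) (Complex.reCLM.comp_memLp' hw.memLp_one)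
    (Complex.reCLM.comp_memLp' hw.memLp_two)
  obtain ⟨im, ism, em⟩ := H.minusForm.integral_form_memLp (hw'.jet Complex.imCLM)
    (Complex.imCLM.comp_memLp' hw.memLp_zero) (Complex.imCLM.comp_memLp' hw.memLp_one)
    (Complex.imCLM.comp_memLp' hw.memLp_two)
  rw [secondVariationLine_eq h₀ h₁ hw' (hw'.jet Complex.reCLM) (hw'.jet Complex.imCLM)
    (fun _ => rfl) (fun _ => rfl) (fun _ => rfl) (fun _ => rfl) (fun _ => rfl) (fun _ => rfl),
    integral_const_mul, integral_add ip im, ep, em]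
  have np : 0 ≤ ∫ x, H.plusForm.sq (hw'.jet Complex.reCLM) (hw'.jet Complex.reCLM) x :=
    integral_nonneg (H.plusForm.sq_self_nonneg _)
  have nm : 0 ≤ ∫ x, H.minusForm.sq (hw'.jet Complex.imCLM) (hw'.jet Complex.imCLM) x :=
    integral_nonneg (H.minusForm.sq_self_nonneg _)
  refine lt_of_le_of_ne (by linarith) fun h => hne ?_
  refine IsNeutral.eq_zero_of_memLp h₀ h₁ hw'.contDiff.continuous
    (isNeutral_of_ae_sq_eq_zero h₀ h₁ hw' ?_ ?_) hw.memLp_zero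
  · exact (integral_eq_zero_iff_of_nonneg (H.plusForm.sq_self_nonneg _) isp).1 (by linarith)
  · exact (integral_eq_zero_iff_of_nonneg (H.minusForm.sq_self_nonneg _) ism).1 (by linarith)

lemma deriv_ofReal_mul {c : ℂ} {ψ : ℝ → ℝ} (h : Differentiable ℝ ψ) :
    deriv (fun x => c * (ψ x : ℂ)) = fun x => c * ((deriv ψ x : ℝ) : ℂ) :=
  funext fun x => ((h x).hasDerivAt.ofReal_comp.const_mul c).deriv

theorem secondVariationLine_eq_zero_iff (h₀ : 0 < ℰ) (h₁ : ℰ < 1) (hw : MemH2Loc w)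
    (hb : ∃ C : ℝ, ∀ x, ‖w x‖ ≤ C) :
    (∀ φ : ℝ → ℂ, ContDiff ℝ ∞ φ → HasCompactSupport φ → secondVariationLine ℰ 2 w φ = 0) ↔
      IsNeutral ℰ w := by
  have H := isCnoidal_profile h₀ h₁
  constructor
  · intro hweak
    obtain ⟨C, hC⟩ := hb
    have hz : ContDiff ℝ ∞ fun _ : ℝ => (0 : ℝ) := contDiff_const
    -- Test functions `c ψ` with `ψ` real: `c = 1` isolates the equation for the real part and `c =
    -- I` that for the imaginary part.
    have test : ∀ (c : ℂ) (ψ : ℝ → ℝ) (_ : ContDiff ℝ ∞ ψ) (_ : HasCompactSupport ψ)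
        (f h : H2Jet), (∀ x, f.f₀ x = c.re * ψ x ∧ f.f₁ x = c.re * deriv ψ x ∧
          f.f₂ x = c.re * deriv (deriv ψ) x) → (∀ x, h.f₀ x = c.im * ψ x ∧
          h.f₁ x = c.im * deriv ψ x ∧ h.f₂ x = c.im * deriv (deriv ψ) x) →
        ∫ x, 2 * (H.plusForm.form (hw.jet Complex.reCLM) f x
          + H.minusForm.form (hw.jet Complex.imCLM) h x) = 0 := by
      intro c ψ hψ hψc f h hf hh
      have d := contDiff_infty_iff_deriv.1 hψ
      have d' := contDiff_infty_iff_deriv.1 d.2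
      have e₁ := deriv_ofReal_mul (c := c) d.1
      have e₂ : deriv (deriv fun x => c * (ψ x : ℂ)) =
          fun x => c * ((deriv (deriv ψ) x : ℝ) : ℂ) := by
        rw [e₁, deriv_ofReal_mul d'.1]
      rw [← hweak (fun x => c * (ψ x : ℂ)) (contDiff_const.mul (Complex.ofRealCLM.contDiff.comp hψ))
        ((hψc.comp_left Complex.ofReal_zero).mul_left)]
      symm
      apply secondVariationLine_eq h₀ h₁ hw f h <;> intro x
      · rw [(hf x).1, Complex.re_mul_ofReal]
      · rw [(hf x).2.1, e₁, Complex.re_mul_ofReal]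
      · rw [(hf x).2.2, e₂, Complex.re_mul_ofReal]
      · rw [(hh x).1, Complex.im_mul_ofReal]
      · rw [(hh x).2.1, e₁, Complex.im_mul_ofReal]
      · rw [(hh x).2.2, e₂, Complex.im_mul_ofReal]
    have zjet : ∀ (F : SquareForm) (f : H2Jet) (x : ℝ), F.form f (.ofSmooth _ hz) x = 0 := by
      intro F f x
      simp [SquareForm.form, H2Jet.ofSmooth, H2Jet.ofContinuous]
    refine isNeutral_of_ae_sq_eq_zero h₀ h₁ hw ?_ ?_
    · refine H.plusForm.ae_sq_eq_zero_of_bounded_weak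
        ⟨C, fun x => (Complex.abs_re_le_norm _).trans (hC x)⟩ fun ψ hψ hψc => ?_
      obtain ⟨R, -, hR⟩ := H2Jet.exists_vanishesOutside_ofSmooth hψ hψc
      have := test 1 ψ hψ hψc (.ofSmooth ψ hψ) (.ofSmooth _ hz)
        (fun x => by simp [H2Jet.ofSmooth]) (fun x => by simp [H2Jet.ofSmooth])
      simp only [zjet, add_zero, integral_const_mul] at this
      rw [← H.plusForm.integral_form_compact _ _ hR]
      linarith
    · refine H.minusForm.ae_sq_eq_zero_of_bounded_weak
        ⟨C, fun x => (Complex.abs_im_le_norm _).trans (hC x)⟩ fun ψ hψ hψc => ?_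
      obtain ⟨R, -, hR⟩ := H2Jet.exists_vanishesOutside_ofSmooth hψ hψc
      have := test Complex.I ψ hψ hψc (.ofSmooth _ hz) (.ofSmooth ψ hψ)
        (fun x => by simp [H2Jet.ofSmooth]) (fun x => by simp [H2Jet.ofSmooth])
      simp only [zjet, zero_add, integral_const_mul] at this
      rw [← H.minusForm.integral_form_compact _ _ hR]
      linarith
  · intro hn φ hφ hφc
    have hd := contDiff_infty_iff_deriv.1 hφ
    have hd' := contDiff_infty_iff_deriv.1 hd.2
    have jet : ∀ L : ℂ →L[ℝ] ℝ, ∃ f : H2Jet, (∀ x, f.f₀ x = L (φ x) ∧ f.f₁ x = L (deriv φ x) ∧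
        f.f₂ x = L (deriv (deriv φ) x)) ∧ ∃ R, 0 < R ∧ SquareForm.VanishesOutside f R := by
      intro L
      refine ⟨.ofContinuous (fun x => L (φ x)) (fun x => L (deriv φ x))
        (fun x => L (deriv (deriv φ) x))
        (fun x => L.hasFDerivAt.comp_hasDerivAt x (hd.1 x).hasDerivAt)
        (fun x => L.hasFDerivAt.comp_hasDerivAt x (hd'.1 x).hasDerivAt)
        (L.continuous.comp hd'.2.continuous), fun x => ⟨rfl, rfl, rfl⟩, ?_⟩
      exact exists_vanishesOutside (hφc.comp_left L.map_zero) (hφc.deriv.comp_left L.map_zero)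
        (hφc.deriv.deriv.comp_left L.map_zero)
    obtain ⟨f, hf, R, -, hR⟩ := jet Complex.reCLM
    obtain ⟨h, hh, R', -, hR'⟩ := jet Complex.imCLM
    -- Compact support of the test function makes each form integrable, so the integral of the sum
    -- splits.
    have integrable : ∀ (F : SquareForm) (u v : H2Jet) (R : ℝ), SquareForm.VanishesOutside v R →
        Integrable (F.form u v) := by
      intro F u v R hv
      have hs : Function.support (F.form u v) ⊆ Icc (-R) R := fun x hx => by
        by_contra hx'
        refine hx ?_
        obtain ⟨v0, v1, v2⟩ := hv x (not_lt.1 fun hlt => hx' (abs_le.1 hlt.le))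
        simp [SquareForm.form, v0, v1, v2]
      exact (integrableOn_iff_integrable_of_support_subset hs).1
        ((F.loc_form u v).integrableOn_isCompact isCompact_Icc)
    rw [secondVariationLine_eq h₀ h₁ hw f h (fun x => (hf x).1) (fun x => (hf x).2.1)
      (fun x => (hf x).2.2) (fun x => (hh x).1) (fun x => (hh x).2.1) (fun x => (hh x).2.2),
      integral_const_mul, integral_add (integrable _ _ _ R hR) (integrable _ _ _ R' hR'),
      H.plusForm.integral_form_compact _ _ hR, H.minusForm.integral_form_compact _ _ hR']
    simp only [(hn.sq_eq_zero h₀ h₁ hw _ _).1, (hn.sq_eq_zero h₀ h₁ hw _ _).2]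
    simp

end Main

end CnoidalNLS

theorem proposition3 (ℰ : ℝ) (hℰ₀ : 0 < ℰ) (hℰ₁ : ℰ < 1) :
    -- perturbations whose period is a multiple of the period of the wave
    (∀ N : ℕ, 1 ≤ N → ∀ w : ℝ → ℂ, CnoidalNLS.MemH2Per (N * CnoidalNLS.period ℰ) w →
      0 ≤ CnoidalNLS.secondVariationPer ℰ 2 (N * CnoidalNLS.period ℰ) w ∧
      (CnoidalNLS.secondVariationPer ℰ 2 (N * CnoidalNLS.period ℰ) w = 0 ↔
        CnoidalNLS.IsNeutral ℰ w)) ∧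
    -- localized perturbations
    (∀ w : ℝ → ℂ, CnoidalNLS.MemH2 w → w ≠ 0 →
      0 < CnoidalNLS.secondVariationLine ℰ 2 w w) ∧
    -- the bounded zero modes on the line
    (∀ w : ℝ → ℂ, CnoidalNLS.MemH2Loc w → (∃ C : ℝ, ∀ x, ‖w x‖ ≤ C) →
      ((∀ φ : ℝ → ℂ, ContDiff ℝ ∞ φ → HasCompactSupport φ →
          CnoidalNLS.secondVariationLine ℰ 2 w φ = 0) ↔
        CnoidalNLS.IsNeutral ℰ w)) :=
  ⟨fun _ hN _ hw => CnoidalNLS.secondVariationPer_nonneg_and_eq_zero_iff hℰ₀ hℰ₁ hN hw,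
    fun _ hw hne => CnoidalNLS.secondVariationLine_pos hℰ₀ hℰ₁ hw hne,
    fun _ hw hb => CnoidalNLS.secondVariationLine_eq_zero_iff hℰ₀ hℰ₁ hw hb⟩
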